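/- Conventions. Double categories are strict. $[\,\cdot\,|\,\cdot\,]$ denotes horizontal and $\frac{\ \cdot\ }{\cdot}$ vertical composition, both in diagrammatic order. Lax double functors are lax in the horizontal and strict in the vertical direction. A 2-cell is horizontally (vertically) globular if its vertical (horizontal) sides are identities. A vertical strict transformation $\alpha:F\Rightarrow G$ has 1v-cell components $\alpha(A):F(A)\to G(A)$, natural in 1v-cells, and 2-cells $\alpha_f$ from $F(f)$ to $G(f)$ for 1h-cells $f$, compatible with compositors, unitors and 2-cells; it is invertible if all $\alpha_f$ are vertically invertible (including their sides). A companion of a 1v-cell $u:A\to B$ is a 1h-cell $\hat u:A\to B$ with 2-cells $\eta_u$ (top $\mathrm{id}_A$, left $\mathrm{id}_A$, right $u$, bottom $\hat u$) and $\varepsilon_u$ (top $\hat u$, left $u$, right $\mathrm{id}_B$, bottom $\mathrm{id}_B$) such that $[\eta_u|\varepsilon_u]=\mathrm{Id}_{\hat u}$ and $\frac{\eta_u}{\varepsilon_u}=\mathrm{Id}^u$; the composite $\frac uv$ carries the companion $[\hat u|\hat v]$ with the diagonal composites of the structure 2-cells. If the components of $\alpha$ have chosen companions $\hat\alpha(A)$,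 the induced horizontal transformation $\hat\alpha$ has components $\hat\alpha(A)$, 2-cells $\delta_{\hat\alpha,f}=[\eta_{\alpha(A)}|\alpha_f|\varepsilon_{\alpha(B)}]$ for $f:A\to B$, and, for $u:A\to \tilde A$, $\hat\alpha^u=\Big[\tfrac{\mathrm{Id}^{F(u)}}{\eta_{\alpha(\tilde A)}}\Big|\tfrac{\varepsilon_{\alpha(A)}}{\mathrm{Id}^{G(u)}}\Big]$. Let $\mathbb B,\mathbb D$ be double categories. Let $F,G:\mathbb B\to\mathbb D$ be lax double functors, and let $\alpha_1,\dots,\alpha_k$ and $\beta_1,\dots,\beta_l$ ($k,l\ge 1$) be two composable strings of vertical strict transformations between lax double functors $\mathbb B\to\mathbb D$, both leading from $F$ to $G$. Suppose that all 1v-cell components $\alpha_i(A)$, $\beta_j(A)$ have companions in $\mathbb D$, and fix a choice of them. Let $u_A=\alpha_1(A)/\cdots/\alpha_k(A)$ and $v_A=\beta_1(A)/\cdots/\beta_l(A)$ (vertical composites) be the components of the composite transformations, with composite companions $\hat u_A=[\hat\alpha_1(A)|\dots|\hat\alpha_k(A)]$ and $\hat v_A=[\hat\beta_1(A)|\dots|\hat\beta_l(A)]$.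 Let $\omega$ be an identity vertical modification from the composite of the $\alpha_i$ to the composite of the $\beta_j$, i.e. a vertical modification all of whose components $\omega(A):u_A\Rightarrow v_A$ are identity 2-cells (so $u_A=v_A$). Then: 1. The composites of the $\hat\alpha_i$ and of the $\hat\beta_j$ are horizontal oplax transformations $F\Rightarrow G$, and the horizontally globular 2-cells $\hat\omega(A)=[\eta_{u_A}|\omega(A)|\varepsilon_{v_A}]:\hat v_A\Rightarrow\hat u_A$ form a horizontal modification from the composite of the $\hat\beta_j$ to the composite of the $\hat\alpha_i$. 2. For every $A$, the assignment $x\mapsto[\eta_{u_A}|x|\varepsilon_{v_A}]$, which takes $\omega(A)$ to $\hat\omega(A)$, is a bijection from the vertically globular 2-cells $u_A\Rightarrow v_A$ to the horizontally globular 2-cells $\hat v_A\Rightarrow\hat u_A$. 3. If all $\alpha_i$ and $\beta_j$ are invertible, then the horizontal modification $\hat\omega$ is invertible. 4. Each $\hat\omega(A)$ is the companion comparison isomorphism $\theta_{\hat v_A,\hat u_A}$: it is invertible under vertical composition, and it is the unique horizontally globular 2-cell $x:\hat v_A\Rightarrow\hat u_A$ for which the vertical composite of $\eta_{v_A}$,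 $x$, $\varepsilon_{u_A}$ (in this order) is $\mathrm{Id}^{v_A}$. 5. Let $(\omega_i)_{i}$ be any family of identity vertical modifications as above (each with its own $F_i,G_i:\mathbb B\to\mathbb D$, strings of transformations and choice of companions). Then every sensible equation between their lifts holds: if two horizontally globular 2-cells are both obtained by vertical and horizontal composition from the 2-cells $\hat\omega_i(A)$ and from identity 2-cells on companions, and if they have the same source and the same target, as 1v-cells equipped with (composites of) chosen companions, then they are equal. -/

import Mathlib

/-- A (strict) double category: 0-cells, 1h-cells, 1v-cells and 2-cells (squares).
`hcomp f g` is `[f | g]`, `vcomp u v` is the fraction `u / v`, both in diagrammatic order.  A square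
`Sq f u v g` has top `f`, left side `u`, right side `v` and bottom `g`.
The strict laws between squares whose boundaries are equal only by the laws for 1-cells are
expressed by heterogeneous equality `≍`. -/
structure DblCat where
  Obj : Type*
  H : Obj → Obj → Type*
  V : Obj → Obj → Type*
  hid (A : Obj) : H A A
  hcomp {A B C : Obj} (f : H A B) (g : H B C) : H A C
  vid (A : Obj) : V A A
  vcomp {A B C : Obj} (u : V A B) (v : V B C) : V A C
  Sq {A B A' B' : Obj} (f : H A B) (u : V A A') (v : V B B') (g : H A' B') : Type*
  /-- the vertical identity square `Id_f` on a 1h-cell -/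
  vId {A B : Obj} (f : H A B) : Sq f (vid A) (vid B) f
  /-- the horizontal identity square `Id^u` on a 1v-cell -/
  hId {A A' : Obj} (u : V A A') : Sq (hid A) u u (hid A')
  /-- vertical composition `a / b` of squares -/
  vC {A B A' B' A'' B'' : Obj} {f : H A B} {u : V A A'} {v : V B B'} {g : H A' B'}
    {u' : V A' A''} {v' : V B' B''} {k : H A'' B''}
    (a : Sq f u v g) (b : Sq g u' v' k) : Sq f (vcomp u u') (vcomp v v') k
  /-- horizontal composition `[a | b]` of squares -/
  hC {A B C A' B' C' : Obj} {f : H A B} {f' : H B C} {u : V A A'} {v : V B B'} {w : V C C'}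
    {g : H A' B'} {g' : H B' C'}
    (a : Sq f u v g) (b : Sq f' v w g') : Sq (hcomp f f') u w (hcomp g g')
  hid_hcomp {A B : Obj} (f : H A B) : hcomp (hid A) f = f
  hcomp_hid {A B : Obj} (f : H A B) : hcomp f (hid B) = f
  hcomp_assoc {A B C E : Obj} (f : H A B) (g : H B C) (k : H C E) :
    hcomp (hcomp f g) k = hcomp f (hcomp g k)
  vid_vcomp {A B : Obj} (u : V A B) : vcomp (vid A) u = u
  vcomp_vid {A B : Obj} (u : V A B) : vcomp u (vid B) = u
  vcomp_assoc {A B C E : Obj} (u : V A B) (v : V B C) (w : V C E) :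
    vcomp (vcomp u v) w = vcomp u (vcomp v w)
  vId_vC {A B A' B' : Obj} {f : H A B} {u : V A A'} {v : V B B'} {g : H A' B'}
    (a : Sq f u v g) : vC (vId f) a ≍ a
  vC_vId {A B A' B' : Obj} {f : H A B} {u : V A A'} {v : V B B'} {g : H A' B'}
    (a : Sq f u v g) : vC a (vId g) ≍ a
  vC_assoc {A B A₁ B₁ A₂ B₂ A₃ B₃ : Obj} {f : H A B} {u : V A A₁} {v : V B B₁} {g : H A₁ B₁}
    {u₁ : V A₁ A₂} {v₁ : V B₁ B₂} {k : H A₂ B₂} {u₂ : V A₂ A₃} {v₂ : V B₂ B₃} {l : H A₃ B₃}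
    (a : Sq f u v g) (b : Sq g u₁ v₁ k) (c : Sq k u₂ v₂ l) :
    vC (vC a b) c ≍ vC a (vC b c)
  hId_hC {A B A' B' : Obj} {f : H A B} {u : V A A'} {v : V B B'} {g : H A' B'}
    (a : Sq f u v g) : hC (hId u) a ≍ a
  hC_hId {A B A' B' : Obj} {f : H A B} {u : V A A'} {v : V B B'} {g : H A' B'}
    (a : Sq f u v g) : hC a (hId v) ≍ a
  hC_assoc {A B C E A' B' C' E' : Obj} {f : H A B} {f₁ : H B C} {f₂ : H C E}
    {u : V A A'} {v : V B B'} {w : V C C'} {t : V E E'}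
    {g : H A' B'} {g₁ : H B' C'} {g₂ : H C' E'}
    (a : Sq f u v g) (b : Sq f₁ v w g₁) (c : Sq f₂ w t g₂) :
    hC (hC a b) c ≍ hC a (hC b c)
  interchange {A B C A' B' C' A'' B'' C'' : Obj} {f : H A B} {f' : H B C}
    {u : V A A'} {v : V B B'} {w : V C C'} {g : H A' B'} {g' : H B' C'}
    {u' : V A' A''} {v' : V B' B''} {w' : V C' C''} {k : H A'' B''} {k' : H B'' C''}
    (a : Sq f u v g) (b : Sq f' v w g') (c : Sq g u' v' k) (d : Sq g' v' w' k') :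
    hC (vC a c) (vC b d) = vC (hC a b) (hC c d)
  vId_hcomp {A B C : Obj} (f : H A B) (g : H B C) : vId (hcomp f g) = hC (vId f) (vId g)
  hId_vcomp {A B C : Obj} (u : V A B) (v : V B C) : hId (vcomp u v) = vC (hId u) (hId v)
  hId_vid (A : Obj) : hId (vid A) = vId (hid A)

namespace DblCat

/-- Transport of a square along equalities of its boundary 1-cells. -/
def cast (D : DblCat) {A B A' B' : D.Obj} {f f' : D.H A B} {u u' : D.V A A'} {v v' : D.V B B'}
    {g g' : D.H A' B'} (hf : f = f') (hu : u = u') (hv : v = v') (hg : g = g')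
    (a : D.Sq f u v g) : D.Sq f' u' v' g' := by
  subst hf hu hv hg; exact a

theorem cast_heq (D : DblCat) {A B A' B' : D.Obj} {f f' : D.H A B} {u u' : D.V A A'}
    {v v' : D.V B B'} {g g' : D.H A' B'} (hf : f = f') (hu : u = u') (hv : v = v') (hg : g = g')
    (a : D.Sq f u v g) : D.cast hf hu hv hg a ≍ a := by
  subst hf hu hv hg; rfl

theorem vC_congr (D : DblCat) {A B A' B' A'' B'' : D.Obj} {f f₁ : D.H A B} {u u₁ : D.V A A'}
    {v v₁ : D.V B B'} {g g₁ : D.H A' B'} {u' u₁' : D.V A' A''} {v' v₁' : D.V B' B''}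
    {k k₁ : D.H A'' B''} {a : D.Sq f u v g} {b : D.Sq g u' v' k} {a₁ : D.Sq f₁ u₁ v₁ g₁}
    {b₁ : D.Sq g₁ u₁' v₁' k₁} (ha : a ≍ a₁) (hb : b ≍ b₁)
    (h1 : f = f₁) (h2 : u = u₁) (h3 : v = v₁) (h4 : g = g₁) (h5 : u' = u₁') (h6 : v' = v₁')
    (h7 : k = k₁) : D.vC a b ≍ D.vC a₁ b₁ := by
  subst h1 h2 h3 h4 h5 h6 h7
  cases ha; cases hb; rfl

theorem hC_congr (D : DblCat) {A B C A' B' C' : D.Obj} {f f₁ : D.H A B} {f' f₁' : D.H B C}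
    {u u₁ : D.V A A'} {v v₁ : D.V B B'} {w w₁ : D.V C C'} {g g₁ : D.H A' B'}
    {g' g₁' : D.H B' C'} {a : D.Sq f u v g} {b : D.Sq f' v w g'} {a₁ : D.Sq f₁ u₁ v₁ g₁}
    {b₁ : D.Sq f₁' v₁ w₁ g₁'} (ha : a ≍ a₁) (hb : b ≍ b₁)
    (h1 : f = f₁) (h2 : f' = f₁') (h3 : u = u₁) (h4 : v = v₁) (h5 : w = w₁) (h6 : g = g₁)
    (h7 : g' = g₁') : D.hC a b ≍ D.hC a₁ b₁ := by
  subst h1 h2 h3 h4 h5 h6 h7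
  cases ha; cases hb; rfl

/-- Horizontally globular 2-cells `f ⇒ g`: both vertical sides are identities. -/
abbrev Glob (D : DblCat) {A B : D.Obj} (f g : D.H A B) := D.Sq f (D.vid A) (D.vid B) g

/-- Vertically globular 2-cells `u ⇒ v`: top and bottom are identities. -/
abbrev VGlob (D : DblCat) {A B : D.Obj} (u v : D.V A B) := D.Sq (D.hid A) u v (D.hid B)

/-- Vertical composite of horizontally globular 2-cells, again horizontally globular. -/
def gcomp (D : DblCat) {A B : D.Obj} {f g k : D.H A B} (a : D.Glob f g) (b : D.Glob g k) :
    D.Glob f k :=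
  D.cast rfl (D.vid_vcomp _) (D.vid_vcomp _) rfl (D.vC a b)

/-- Invertibility of a horizontally globular 2-cell with respect to vertical composition. -/
def IsGlobIso (D : DblCat) {A B : D.Obj} {f g : D.H A B} (a : D.Glob f g) : Prop :=
  ∃ b : D.Glob g f, D.gcomp a b = D.vId f ∧ D.gcomp b a = D.vId g

/-- Vertical invertibility of a square (in particular, its vertical sides are invertible). -/
def VertInvertible (D : DblCat) {A B A' B' : D.Obj} {f : D.H A B} {u : D.V A A'} {v : D.V B B'}
    {g : D.H A' B'} (a : D.Sq f u v g) : Prop :=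
  ∃ (u' : D.V A' A) (v' : D.V B' B) (b : D.Sq g u' v' f),
    (D.vcomp u u' = D.vid A ∧ D.vcomp u' u = D.vid A') ∧
    (D.vcomp v v' = D.vid B ∧ D.vcomp v' v = D.vid B') ∧
    D.vC a b ≍ D.vId f ∧ D.vC b a ≍ D.vId g

/-- A companion of a 1v-cell `u`: a 1h-cell with squares `ε`, `η` such that
`[η | ε] = Id` and `η / ε = Id`. -/
structure Companion (D : DblCat) {A B : D.Obj} (u : D.V A B) where
  hat : D.H A B
  ε : D.Sq hat u (D.vid B) (D.hid B)
  η : D.Sq (D.hid A) (D.vid A) u hat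
  hC_η_ε : D.hC η ε ≍ D.vId hat
  vC_η_ε : D.vC η ε ≍ D.hId u

/-- If `u`, `v` have companions `û`, `v̂`, then `u / v` has the companion `[û | v̂]`, whose
structure squares are the diagonal composites of those of `û` and `v̂`. -/
def Companion.comp {D : DblCat} {A B C : D.Obj} {u : D.V A B} {v : D.V B C}
    (c : D.Companion u) (d : D.Companion v) : D.Companion (D.vcomp u v) where
  hat := D.hcomp c.hat d.hat
  ε := D.cast rfl rfl (D.vid_vcomp _) (D.hid_hcomp _)
    (D.vC (D.hC c.ε (D.vId d.hat)) (D.hC (D.hId v) d.ε))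
  η := D.cast (D.hid_hcomp _) (D.vid_vcomp _) rfl rfl
    (D.vC (D.hC c.η (D.hId u)) (D.hC (D.vId c.hat) d.η))
  hC_η_ε := by
    refine (D.hC_congr (D.cast_heq ..) (D.cast_heq ..) (D.hid_hcomp _).symm rfl
      (D.vid_vcomp _).symm rfl (D.vid_vcomp _).symm rfl (D.hid_hcomp _).symm).trans ?_
    rw [D.interchange]
    have e1 : D.hC (D.hC c.η (D.hId u)) (D.hC c.ε (D.vId d.hat))
        ≍ D.vId (D.hcomp c.hat d.hat) := by
      refine (D.hC_congr (D.hC_hId c.η) HEq.rfl (D.hid_hcomp _) rfl rfl rfl rfl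
        (D.hcomp_hid _) rfl).trans ?_
      refine (D.hC_assoc ..).symm.trans ?_
      rw [D.vId_hcomp]
      exact D.hC_congr c.hC_η_ε HEq.rfl (D.hid_hcomp _) rfl rfl rfl rfl (D.hcomp_hid _) rfl
    have e2 : D.hC (D.hC (D.vId c.hat) d.η) (D.hC (D.hId v) d.ε)
        ≍ D.vId (D.hcomp c.hat d.hat) := by
      refine (D.hC_congr HEq.rfl (D.hId_hC d.ε) rfl (D.hid_hcomp _) rfl rfl rfl rfl
        (D.hid_hcomp _)).trans ?_
      refine (D.hC_assoc ..).trans ?_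
      rw [D.vId_hcomp]
      exact D.hC_congr HEq.rfl d.hC_η_ε rfl (D.hid_hcomp _) rfl rfl rfl rfl (D.hcomp_hid _)
    refine (D.vC_congr e1 e2 ?_ rfl rfl ?_ rfl rfl ?_).trans (D.vId_vC _) <;>
      simp only [D.hid_hcomp, D.hcomp_hid]
  vC_η_ε := by
    refine (D.vC_congr (D.cast_heq ..) (D.cast_heq ..) (D.hid_hcomp _).symm
      (D.vid_vcomp _).symm rfl rfl rfl (D.vid_vcomp _).symm (D.hid_hcomp _).symm).trans ?_
    refine (D.vC_assoc ..).trans ?_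
    have m : D.vC (D.hC (D.vId c.hat) d.η) (D.hC c.ε (D.vId d.hat)) ≍ D.vC c.ε d.η := by
      rw [← D.interchange]
      refine (D.hC_congr ((D.vId_vC _).trans (D.vC_vId _).symm)
        ((D.vC_vId _).trans (D.vId_vC _).symm) rfl rfl ?_ ?_ ?_ rfl rfl).trans ?_
      · simp only [D.vid_vcomp, D.vcomp_vid]
      · simp only [D.vid_vcomp]
      · simp only [D.vid_vcomp, D.vcomp_vid]
      · rw [D.interchange, ← D.hId_vid]
        exact D.vC_congr (D.hC_hId _) (D.hId_hC _) (D.hcomp_hid _) rfl rfl (D.hid_hcomp _)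
          rfl rfl (D.hid_hcomp _)
    have m' : D.vC (D.hC (D.vId c.hat) d.η)
          (D.vC (D.hC c.ε (D.vId d.hat)) (D.hC (D.hId v) d.ε)) ≍ D.vC c.ε (D.vC d.η d.ε) := by
      refine (D.vC_assoc ..).symm.trans (HEq.trans ?_ (D.vC_assoc ..))
      refine D.vC_congr m (D.hId_hC _) (D.hcomp_hid _) ?_ ?_ (D.hid_hcomp _) rfl rfl
        (D.hid_hcomp _) <;> simp only [D.vid_vcomp, D.vcomp_vid]
    refine (D.vC_congr (D.hC_hId _) m' (D.hid_hcomp _) rfl rfl (D.hcomp_hid _) ?_ ?_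
      (D.hid_hcomp _)).trans ?_
    · simp only [D.vid_vcomp]
    · simp only [D.vcomp_vid, D.vid_vcomp]
    · refine (D.vC_assoc ..).symm.trans ?_
      rw [D.hId_vcomp]
      refine D.vC_congr c.vC_η_ε d.vC_η_ε rfl ?_ ?_ rfl ?_ ?_ rfl <;>
        simp only [D.vid_vcomp, D.vcomp_vid]

/-- The assignment `x ↦ [η_u | x | ε_v]` sending vertically globular 2-cells `u ⇒ v` to
horizontally globular 2-cells `v̂ ⇒ û`. -/
def lift (D : DblCat) {A B : D.Obj} {u v : D.V A B} (c : D.Companion u) (d : D.Companion v)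
    (x : D.VGlob u v) : D.Glob d.hat c.hat :=
  D.cast ((congrArg (D.hcomp · d.hat) (D.hid_hcomp _)).trans (D.hid_hcomp _)) rfl rfl
    ((D.hcomp_hid _).trans (D.hcomp_hid _)) (D.hC (D.hC c.η x) d.ε)

/-- A 1v-cell together with a chosen companion. -/
structure CompanionPair (D : DblCat) (A B : D.Obj) where
  vert : D.V A B
  companion : D.Companion vert

/-- The 1h-cell of a companion pair. -/
abbrev CompanionPair.hat {D : DblCat} {A B : D.Obj} (p : D.CompanionPair A B) : D.H A B :=
  p.companion.hat

/-- The composite `(u / v, [û | v̂])` of companion pairs. -/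
def CompanionPair.comp {D : DblCat} {A B C : D.Obj} (p : D.CompanionPair A B)
    (q : D.CompanionPair B C) : D.CompanionPair A C :=
  ⟨D.vcomp p.vert q.vert, p.companion.comp q.companion⟩

/-- The defining property `η / x / ε' = Id^u` of the comparison cell `θ` between two companions
of one and the same 1v-cell. -/
def IsComparison (D : DblCat) {A B : D.Obj} (p q : D.CompanionPair A B)
    (x : D.Glob p.hat q.hat) : Prop :=
  p.vert = q.vert ∧ D.vC (D.vC p.companion.η x) q.companion.ε ≍ D.hId p.vert

/-- Pasting composites of a given family of horizontally globular 2-cells `x j` between companions: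
everything obtained from the `x j` and from identities by vertical and horizontal composition.
Source and target are recorded as (composites of) chosen companions. -/
inductive Pasting (D : DblCat) {J : Type*} {s t : J → D.Obj}
    (dom cod : ∀ j, D.CompanionPair (s j) (t j)) (x : ∀ j, D.Glob (dom j).hat (cod j).hat) :
    ∀ {A B : D.Obj} (p q : D.CompanionPair A B), D.Glob p.hat q.hat → Prop
  | of (j : J) : Pasting D dom cod x (dom j) (cod j) (x j)
  | id {A B : D.Obj} (p : D.CompanionPair A B) : Pasting D dom cod x p p (D.vId p.hat)
  | vert {A B : D.Obj} {p q r : D.CompanionPair A B} {a : D.Glob p.hat q.hat}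
      {b : D.Glob q.hat r.hat} (ha : Pasting D dom cod x p q a) (hb : Pasting D dom cod x q r b) :
      Pasting D dom cod x p r (D.gcomp a b)
  | horiz {A B C : D.Obj} {p q : D.CompanionPair A B} {p' q' : D.CompanionPair B C}
      {a : D.Glob p.hat q.hat} {b : D.Glob p'.hat q'.hat}
      (ha : Pasting D dom cod x p q a) (hb : Pasting D dom cod x p' q' b) :
      Pasting D dom cod x (p.comp p') (q.comp q') (D.hC a b)

end DblCat

/-- A (horizontally) lax double functor: strict in the vertical direction, with compositor
`[F f | F g] ⇒ F [f | g]` and unitor `1 ⇒ F 1`. -/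
structure LaxFunctor (B : DblCat) (D : DblCat) where
  obj : B.Obj → D.Obj
  mapH {X Y : B.Obj} (f : B.H X Y) : D.H (obj X) (obj Y)
  mapV {X Y : B.Obj} (u : B.V X Y) : D.V (obj X) (obj Y)
  mapSq {X Y X' Y' : B.Obj} {f : B.H X Y} {u : B.V X X'} {v : B.V Y Y'} {g : B.H X' Y'}
    (a : B.Sq f u v g) : D.Sq (mapH f) (mapV u) (mapV v) (mapH g)
  compositor {X Y Z : B.Obj} (f : B.H X Y) (g : B.H Y Z) :
    D.Glob (D.hcomp (mapH f) (mapH g)) (mapH (B.hcomp f g))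
  unitor (X : B.Obj) : D.Glob (D.hid (obj X)) (mapH (B.hid X))
  mapV_vcomp {X Y Z : B.Obj} (u : B.V X Y) (v : B.V Y Z) :
    mapV (B.vcomp u v) = D.vcomp (mapV u) (mapV v)
  mapV_vid (X : B.Obj) : mapV (B.vid X) = D.vid (obj X)
  mapSq_vC {X Y X' Y' X'' Y'' : B.Obj} {f : B.H X Y} {u : B.V X X'} {v : B.V Y Y'}
    {g : B.H X' Y'} {u' : B.V X' X''} {v' : B.V Y' Y''} {k : B.H X'' Y''}
    (a : B.Sq f u v g) (b : B.Sq g u' v' k) : mapSq (B.vC a b) ≍ D.vC (mapSq a) (mapSq b)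
  mapSq_vId {X Y : B.Obj} (f : B.H X Y) : mapSq (B.vId f) ≍ D.vId (mapH f)
  compositor_assoc {X Y Z W : B.Obj} (f : B.H X Y) (g : B.H Y Z) (k : B.H Z W) :
    D.vC (D.hC (compositor f g) (D.vId (mapH k))) (compositor (B.hcomp f g) k) ≍
      D.vC (D.hC (D.vId (mapH f)) (compositor g k)) (compositor f (B.hcomp g k))
  unitor_left {X Y : B.Obj} (f : B.H X Y) :
    D.vC (D.hC (unitor X) (D.vId (mapH f))) (compositor (B.hid X) f) ≍ D.vId (mapH f)
  unitor_right {X Y : B.Obj} (f : B.H X Y) :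
    D.vC (D.hC (D.vId (mapH f)) (unitor Y)) (compositor f (B.hid Y)) ≍ D.vId (mapH f)
  compositor_nat {X Y Z X' Y' Z' : B.Obj} {f : B.H X Y} {g : B.H Y Z} {u : B.V X X'}
    {v : B.V Y Y'} {w : B.V Z Z'} {f' : B.H X' Y'} {g' : B.H Y' Z'}
    (a : B.Sq f u v f') (b : B.Sq g v w g') :
    D.vC (D.hC (mapSq a) (mapSq b)) (compositor f' g') ≍
      D.vC (compositor f g) (mapSq (B.hC a b))
  unitor_nat {X X' : B.Obj} (u : B.V X X') :
    D.vC (D.hId (mapV u)) (unitor X') ≍ D.vC (unitor X) (mapSq (B.hId u))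

/-- A vertical strict transformation between lax double functors: the vertically globular
structure 2-cells at 1v-cells are identities, i.e. the 1v-cell components are natural (`nat`). -/
structure VStrict {B D : DblCat} (F G : LaxFunctor B D) where
  app (X : B.Obj) : D.V (F.obj X) (G.obj X)
  cell {X Y : B.Obj} (f : B.H X Y) : D.Sq (F.mapH f) (app X) (app Y) (G.mapH f)
  nat {X X' : B.Obj} (u : B.V X X') : D.vcomp (app X) (G.mapV u) = D.vcomp (F.mapV u) (app X')
  cell_compositor {X Y Z : B.Obj} (f : B.H X Y) (g : B.H Y Z) :
    D.vC (D.hC (cell f) (cell g)) (G.compositor f g) ≍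
      D.vC (F.compositor f g) (cell (B.hcomp f g))
  cell_unitor (X : B.Obj) :
    D.vC (F.unitor X) (cell (B.hid X)) ≍ D.vC (D.hId (app X)) (G.unitor X)
  cell_nat {X Y X' Y' : B.Obj} {f : B.H X Y} {u : B.V X X'} {v : B.V Y Y'} {g : B.H X' Y'}
    (a : B.Sq f u v g) : D.vC (F.mapSq a) (cell g) ≍ D.vC (cell f) (G.mapSq a)

/-- Invertibility of a vertical strict transformation: its 2-cells `α_f` are vertically
invertible. -/
def VStrict.IsInvertible {B D : DblCat} {F G : LaxFunctor B D} (α : VStrict F G) : Prop :=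
  ∀ {X Y : B.Obj} (f : B.H X Y), D.VertInvertible (α.cell f)

/-- Vertical composition of vertical strict transformations. -/
def VStrict.comp {B D : DblCat} {F G K : LaxFunctor B D} (α : VStrict F G) (β : VStrict G K) :
    VStrict F K where
  app X := D.vcomp (α.app X) (β.app X)
  cell f := D.vC (α.cell f) (β.cell f)
  nat u := by
    rw [D.vcomp_assoc, β.nat, ← D.vcomp_assoc, α.nat, D.vcomp_assoc]
  cell_compositor f g := by
    rw [D.interchange]
    refine (D.vC_assoc ..).trans ?_
    refine (D.vC_congr HEq.rfl (β.cell_compositor f g) rfl rfl rfl rfl ?_ ?_ rfl).trans ?_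
    · simp only [D.vid_vcomp, D.vcomp_vid]
    · simp only [D.vid_vcomp, D.vcomp_vid]
    refine (D.vC_assoc ..).symm.trans ?_
    refine (D.vC_congr (α.cell_compositor f g) HEq.rfl rfl ?_ ?_ rfl rfl rfl rfl).trans
      (D.vC_assoc ..)
    · simp only [D.vid_vcomp, D.vcomp_vid]
    · simp only [D.vid_vcomp, D.vcomp_vid]
  cell_unitor X := by
    refine (D.vC_assoc ..).symm.trans ?_
    refine (D.vC_congr (α.cell_unitor X) HEq.rfl rfl ?_ ?_ rfl rfl rfl rfl).trans ?_
    · simp only [D.vid_vcomp, D.vcomp_vid]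
    · simp only [D.vid_vcomp, D.vcomp_vid]
    refine (D.vC_assoc ..).trans ?_
    rw [D.hId_vcomp]
    refine (D.vC_congr HEq.rfl (β.cell_unitor X) rfl rfl rfl rfl ?_ ?_ rfl).trans
      (D.vC_assoc ..).symm
    · simp only [D.vid_vcomp, D.vcomp_vid]
    · simp only [D.vid_vcomp, D.vcomp_vid]
  cell_nat a := by
    refine (D.vC_assoc ..).symm.trans ?_
    refine (D.vC_congr (α.cell_nat a) HEq.rfl rfl (α.nat _).symm (α.nat _).symm rfl rfl rfl
      rfl).trans ?_
    refine (D.vC_assoc ..).trans ?_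
    exact (D.vC_congr HEq.rfl (β.cell_nat a) rfl rfl rfl rfl (β.nat _).symm (β.nat _).symm
      rfl).trans (D.vC_assoc ..).symm

/-- A vertical modification between vertical strict transformations (vertically globular). -/
structure VModification {B D : DblCat} {F G : LaxFunctor B D} (α β : VStrict F G) where
  app (X : B.Obj) : D.VGlob (α.app X) (β.app X)
  horiz {X Y : B.Obj} (f : B.H X Y) : D.hC (α.cell f) (app Y) ≍ D.hC (app X) (β.cell f)
  vert {X X' : B.Obj} (u : B.V X X') :
    D.vC (D.hId (F.mapV u)) (app X') ≍ D.vC (app X) (D.hId (G.mapV u))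

/-- The modification is an identity: each of its components is an identity 2-cell. -/
def VModification.IsIdentity {B D : DblCat} {F G : LaxFunctor B D} {α β : VStrict F G}
    (ω : VModification α β) : Prop :=
  ∀ X, α.app X = β.app X ∧ ω.app X ≍ D.hId (α.app X)

/-- The data of a horizontal oplax transformation between lax double functors. -/
structure HorTransData {B D : DblCat} (F G : LaxFunctor B D) where
  app (X : B.Obj) : D.H (F.obj X) (G.obj X)
  vcell {X X' : B.Obj} (u : B.V X X') : D.Sq (app X) (F.mapV u) (G.mapV u) (app X')
  δ {X Y : B.Obj} (f : B.H X Y) :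
    D.Glob (D.hcomp (F.mapH f) (app Y)) (D.hcomp (app X) (G.mapH f))

/-- The data form a horizontal oplax transformation. -/
structure HorTransData.IsOplax {B D : DblCat} {F G : LaxFunctor B D} (α : HorTransData F G) :
    Prop where
  compositor {X Y Z : B.Obj} (f : B.H X Y) (g : B.H Y Z) :
    D.vC (D.hC (F.compositor f g) (D.vId (α.app Z))) (α.δ (B.hcomp f g)) ≍
      D.vC (D.vC (D.hC (D.vId (F.mapH f)) (α.δ g))
          (D.cast (D.hcomp_assoc _ _ _) rfl rfl rfl (D.hC (α.δ f) (D.vId (G.mapH g)))))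
        (D.cast (D.hcomp_assoc _ _ _).symm rfl rfl rfl
          (D.hC (D.vId (α.app X)) (G.compositor f g)))
  unitor (X : B.Obj) :
    D.vC (D.hC (F.unitor X) (D.vId (α.app X))) (α.δ (B.hid X)) ≍
      D.hC (D.vId (α.app X)) (G.unitor X)
  vcell_vcomp {X Y Z : B.Obj} (u : B.V X Y) (v : B.V Y Z) :
    α.vcell (B.vcomp u v) ≍ D.vC (α.vcell u) (α.vcell v)
  vcell_vid (X : B.Obj) : α.vcell (B.vid X) ≍ D.vId (α.app X)
  nat {X Y X' Y' : B.Obj} {f : B.H X Y} {u : B.V X X'} {v : B.V Y Y'} {g : B.H X' Y'}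
    (a : B.Sq f u v g) :
    D.vC (D.hC (F.mapSq a) (α.vcell v)) (α.δ g) ≍
      D.vC (α.δ f) (D.hC (α.vcell u) (G.mapSq a))

/-- Composition of horizontal oplax transformations `F ⇒ G ⇒ K`. -/
def HorTransData.comp {B D : DblCat} {F G K : LaxFunctor B D} (α : HorTransData F G)
    (β : HorTransData G K) : HorTransData F K where
  app X := D.hcomp (α.app X) (β.app X)
  vcell u := D.hC (α.vcell u) (β.vcell u)
  δ {X Y} f := D.gcomp
    (D.cast (D.hcomp_assoc _ _ _) rfl rfl (D.hcomp_assoc _ _ _)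
      (D.hC (α.δ f) (D.vId (β.app Y))))
    (D.cast rfl rfl rfl (D.hcomp_assoc _ _ _).symm (D.hC (D.vId (α.app X)) (β.δ f)))

/-- A family of horizontally globular 2-cells is a horizontal modification `α ⇛ β`. -/
structure IsHorModification {B D : DblCat} {F G : LaxFunctor B D} (α β : HorTransData F G)
    (Θ : ∀ X, D.Glob (α.app X) (β.app X)) : Prop where
  horiz {X Y : B.Obj} (f : B.H X Y) :
    D.vC (D.hC (D.vId (F.mapH f)) (Θ Y)) (β.δ f) ≍ D.vC (α.δ f) (D.hC (Θ X) (D.vId (G.mapH f)))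
  vert {X X' : B.Obj} (u : B.V X X') :
    D.vC (α.vcell u) (Θ X') ≍ D.vC (Θ X) (β.vcell u)

/-- The horizontal transformation induced by a vertical strict transformation and a choice of
companions of its 1v-cell components: `δ_f = [η | α_f | ε]` and
`α̂^u = [Id^{F u} / η | ε / Id^{G u}]`. -/
def VStrict.hat {B D : DblCat} {F G : LaxFunctor B D} (α : VStrict F G)
    (c : ∀ X, D.Companion (α.app X)) : HorTransData F G where
  app X := (c X).hat
  vcell {X X'} u := D.cast (D.hid_hcomp _) (D.vcomp_vid _) (D.vid_vcomp _) (D.hcomp_hid _)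
    (D.hC (D.vC (D.hId (F.mapV u)) (c X').η)
      (D.cast rfl (α.nat u) rfl rfl (D.vC (c X).ε (D.hId (G.mapV u)))))
  δ {X Y} f := D.cast (congrArg (D.hcomp · (c Y).hat) (D.hid_hcomp _)) rfl rfl (D.hcomp_hid _)
    (D.hC (D.hC (c X).η (α.cell f)) (c Y).ε)

/-- Composable strings `α₁, …, α_k` (`k ≥ 1`) of vertical strict transformations from `F` to `G`
through arbitrary intermediate lax double functors. -/
inductive VChain {B D : DblCat} : LaxFunctor B D → LaxFunctor B D → Type _
  | single {F G : LaxFunctor B D} (α : VStrict F G) : VChain F G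
  | cons {F G K : LaxFunctor B D} (α : VStrict F G) (P : VChain G K) : VChain F K

namespace VChain

variable {B D : DblCat}

/-- The vertical composite `α₁ / … / α_k`. -/
def comp : ∀ {F G : LaxFunctor B D}, VChain F G → VStrict F G
  | _, _, single α => α
  | _, _, cons α P => α.comp P.comp

/-- A choice of companions for all 1v-cell components `α₁(X), …, α_k(X)`. -/
def Companions : ∀ {F G : LaxFunctor B D}, VChain F G → Type _
  | _, _, single α => ∀ X, D.Companion (α.app X)
  | _, _, cons α P => (∀ X, D.Companion (α.app X)) × P.Companions

/-- All the transformations `α₁, …, α_k` are invertible. -/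
def IsInvertible : ∀ {F G : LaxFunctor B D}, VChain F G → Prop
  | _, _, single α => α.IsInvertible
  | _, _, cons α P => α.IsInvertible ∧ P.IsInvertible

/-- The composite companion `[α̂₁(X) | … | α̂_k(X)]` of the component at `X` of the composite. -/
def companion : ∀ {F G : LaxFunctor B D} (P : VChain F G), P.Companions → ∀ X : B.Obj,
    D.Companion (P.comp.app X)
  | _, _, single _, c, X => c X
  | _, _, cons _ P, c, X => (c.1 X).comp (P.companion c.2 X)

/-- The component at `X` of the composite, paired with its composite companion. -/
def pair {F G : LaxFunctor B D} (P : VChain F G) (c : P.Companions) (X : B.Obj) :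
    D.CompanionPair (F.obj X) (G.obj X) :=
  ⟨P.comp.app X, P.companion c X⟩

/-- The composite of the induced horizontal transformations `α̂₁, …, α̂_k`. -/
def hat : ∀ {F G : LaxFunctor B D} (P : VChain F G), P.Companions → HorTransData F G
  | _, _, single α, c => α.hat c
  | _, _, cons α P, c => (α.hat c.1).comp (P.hat c.2)

theorem hat_app : ∀ {F G : LaxFunctor B D} (P : VChain F G) (c : P.Companions) (X : B.Obj),
    (P.companion c X).hat = (P.hat c).app X
  | _, _, single _, _, _ => rfl
  | _, _, cons _ P, c, X => congrArg (D.hcomp (c.1 X).hat) (hat_app P c.2 X)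

end VChain

/-- The components `ω̂(X) = [η | ω(X) | ε]` between the companions of the components of the
composites. -/
def VModification.lift {B D : DblCat} {F G : LaxFunctor B D} {P Q : VChain F G}
    (ω : VModification P.comp Q.comp) (c : P.Companions) (d : Q.Companions) (X : B.Obj) :
    D.Glob (Q.pair d X).hat (P.pair c X).hat :=
  D.lift (P.companion c X) (Q.companion d X) (ω.app X)

/-- The same 2-cells, read between the components of the induced horizontal transformations. -/
def VModification.hat {B D : DblCat} {F G : LaxFunctor B D} {P Q : VChain F G}
    (ω : VModification P.comp Q.comp) (c : P.Companions) (d : Q.Companions) (X : B.Obj) :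
    D.Glob ((Q.hat d).app X) ((P.hat c).app X) :=
  D.cast (Q.hat_app d X) rfl rfl (P.hat_app c X) (ω.lift c d X)

/-! An identity modification forces its two composite transformations to coincide: with identity
components, its axiom [α_f | ω] = [ω | β_f] reads α_f = β_f (`VModification.IsIdentity.eq`).
Moreover the composite of the induced horizontal transformations is the one induced by the composite
with its composite companions (`VStrict.hat_comp`, `VChain.hat_eq`). So everything reduces to one
vertical transformation with two choices of companions, and the lift of an identity is the
comparison cell [η | ε] between them (`lift_eq_companionComparison`).

Two calculi then suffice. Comparison squares [Id^l / η | ε / Id^m] are closed under both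
compositions (`comparison_vC_comparison`, `comparison_hC_comparison`), and for equal companions with
identity sides they are identities. Hence comparison cells are invertible, and any pasting of them
is the comparison cell determined by its source and target pairs (`Pasting.eq_companionComparison`),
which is coherence. Transposes [η | x | ε] are natural against comparison squares
(`transpose_naturality`); this gives the oplax and modification axioms involving δ. The underlying
cancellation is η / ε = Id^u in a middle column (`Companion.zigzag`). The bijection comes from the
two companion identities, with inverse y ↦ η / y / ε. -/

namespace DblCat

variable {D : DblCat}

/-! ### Transport of squares and calculus of whiskered companion squares -/

/-- Supplies a retyped copy of a square as a fresh variable, so that composites whose inner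
boundaries agree only by the 1-cell laws can be written down. -/
theorem exists_heq {A B A' B' : D.Obj} {f f' : D.H A B} {u u' : D.V A A'} {v v' : D.V B B'}
    {g g' : D.H A' B'} (a : D.Sq f u v g) (hf : f' = f) (hu : u' = u) (hv : v' = v)
    (hg : g' = g) : ∃ a' : D.Sq f' u' v' g', a' ≍ a := by
  subst hf hu hv hg; exact ⟨a, HEq.rfl⟩

/-- Deletes a middle column once it is known to be an identity, even if its two sides agree with the
1v-cell only propositionally. -/
theorem heq_hC_hId {A B C A' B' C' : D.Obj} {f f' : D.H A B} {g g' : D.H B C}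
    {u u' : D.V A A'} {m m' n n' : D.V B B'} {v v' : D.V C C'} {h h' : D.H A' B'}
    {k k' : D.H B' C'} {x : D.Sq f u m h} {y : D.Sq g m' v k} {z : D.Sq (D.hid B) m m' (D.hid B')}
    {x' : D.Sq f' u' n h'} {y' : D.Sq g' n v' k'} (hz : z ≍ D.hId n')
    (hx : x ≍ x') (hy : y ≍ y') (hf : f = f') (hg : g = g') (hu : u = u') (hm : m = n)
    (hm' : m' = n) (hn : n' = n) (hv : v = v') (hh : h = h') (hk : k = k') :
    D.hC (D.hC x z) y ≍ D.hC x' y' := by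
  subst hf hg hu hm hm' hn hv hh hk
  cases hz; cases hx; cases hy
  exact D.hC_congr (D.hC_hId x) HEq.rfl (D.hcomp_hid _) rfl rfl rfl rfl (D.hcomp_hid _) rfl

/-- The square `Id^l / η`. -/
def Companion.etaWhisker {A A₁ B : D.Obj} {a : D.V A₁ B} (c : D.Companion a) (l : D.V A A₁) :
    D.Sq (D.hid A) l (D.vcomp l a) c.hat :=
  D.cast rfl (D.vcomp_vid l) rfl rfl (D.vC (D.hId l) c.η)

/-- The square `ε / Id^r`. -/
def Companion.epsWhisker {A B B₁ : D.Obj} {a : D.V A B} (c : D.Companion a) (r : D.V B B₁) :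
    D.Sq c.hat (D.vcomp a r) r (D.hid B₁) :=
  D.cast rfl rfl (D.vid_vcomp r) rfl (D.vC c.ε (D.hId r))

theorem Companion.etaWhisker_heq {A A₁ B : D.Obj} {a : D.V A₁ B} (c : D.Companion a)
    (l : D.V A A₁) : c.etaWhisker l ≍ D.vC (D.hId l) c.η :=
  D.cast_heq ..

theorem Companion.epsWhisker_heq {A B B₁ : D.Obj} {a : D.V A B} (c : D.Companion a)
    (r : D.V B B₁) : c.epsWhisker r ≍ D.vC c.ε (D.hId r) :=
  D.cast_heq ..

theorem Companion.etaWhisker_vid {A B : D.Obj} {a : D.V A B} (c : D.Companion a) :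
    c.etaWhisker (D.vid A) ≍ c.η := by
  have h := c.etaWhisker_heq (D.vid A)
  rw [D.hId_vid] at h
  exact h.trans (D.vId_vC _)

theorem Companion.epsWhisker_vid {A B : D.Obj} {a : D.V A B} (c : D.Companion a) :
    c.epsWhisker (D.vid B) ≍ c.ε := by
  have h := c.epsWhisker_heq (D.vid B)
  rw [D.hId_vid] at h
  exact h.trans (D.vC_vId _)

theorem Companion.hId_vC_etaWhisker {A A₁ A₂ B : D.Obj} {a : D.V A₂ B} (c : D.Companion a)
    (l : D.V A A₁) (l' : D.V A₁ A₂) :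
    D.vC (D.hId l) (c.etaWhisker l') ≍ c.etaWhisker (D.vcomp l l') := by
  have h1 := c.etaWhisker_heq l'
  have h2 := c.etaWhisker_heq (D.vcomp l l')
  have h3 := D.hId_vcomp l l'
  have h4 := D.vC_assoc (D.hId l) (D.hId l') c.η
  have h6 := D.vcomp_vid l'
  -- Here and below, the collected square identities and 1-cell laws are combined by congruence
  -- closure over `≍`.
  grind only

theorem Companion.epsWhisker_vC_hId {A B B₁ B₂ : D.Obj} {a : D.V A B} (c : D.Companion a)
    (r : D.V B B₁) (r' : D.V B₁ B₂) :
    D.vC (c.epsWhisker r) (D.hId r') ≍ c.epsWhisker (D.vcomp r r') := by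
  have h1 := c.epsWhisker_heq r
  have h2 := c.epsWhisker_heq (D.vcomp r r')
  have h3 := D.hId_vcomp r r'
  have h4 := D.vC_assoc c.ε (D.hId r) (D.hId r')
  have h6 := D.vid_vcomp r
  grind only

theorem Companion.etaWhisker_vC_epsWhisker {A A₁ B B₁ : D.Obj} {a : D.V A₁ B}
    (c : D.Companion a) (l : D.V A A₁) (r : D.V B B₁) :
    D.vC (c.etaWhisker l) (c.epsWhisker r) ≍ D.hId (D.vcomp l (D.vcomp a r)) := by
  have h1 := c.etaWhisker_heq l
  have h2 := c.epsWhisker_heq r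
  have h3 := D.hId_vcomp l (D.vcomp a r)
  have h4 := D.hId_vcomp a r
  have h5 := D.vC_assoc c.η c.ε (D.hId r)
  have h6 := D.vC_assoc (D.hId l) c.η (D.vC c.ε (D.hId r))
  have h7 := c.vC_η_ε
  have e1 := D.vcomp_vid l
  have e2 := D.vid_vcomp r
  have e3 := D.vid_vcomp a
  have e4 := D.vcomp_vid a
  have e6 := D.vcomp_assoc (D.vid A₁) a r
  grind only

/-- The companion squares in the middle columns of two composable rows cancel. -/
theorem Companion.zigzag {A₁ B C C' A A' A'' C'' B' : D.Obj} {a : D.V B B'} (c : D.Companion a)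
    {f : D.H A A₁} {k : D.V A A'} {l : D.V A₁ B} {g : D.H A' B} (p : D.Sq f k l g)
    {f' : D.H A₁ C} {t : D.V C C'} {g' : D.H B' C'} (q : D.Sq f' (D.vcomp l a) t g')
    {B'' : D.Obj} {k' : D.V A' A''} {r : D.V B' B''} {h : D.H A'' B''}
    (p' : D.Sq g k' (D.vcomp a r) h)
    {t' : D.V C' C''} {h' : D.H B'' C''} (q' : D.Sq g' r t' h')
    {k'' : D.V A A''} {m : D.V A₁ B''} {t'' : D.V C C''}
    {x : D.Sq f k'' m h} {y : D.Sq f' m t'' h'} (hx : D.vC p p' ≍ x) (hy : D.vC q q' ≍ y)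
    (hk : D.vcomp k k' = k'') (hm : D.vcomp l (D.vcomp a r) = m) (ht : D.vcomp t t' = t'') :
    D.vC (D.hC (D.hC p (c.etaWhisker l)) q) (D.hC (D.hC p' (c.epsWhisker r)) q')
      ≍ D.hC x y := by
  -- Interchange turns the two rows into three columns; the middle one is η over ε, an identity, and
  -- disappears.
  rw [← D.interchange, ← D.interchange]
  exact heq_hC_hId (c.etaWhisker_vC_epsWhisker l r) hx hy rfl rfl hk hm
    ((D.vcomp_assoc ..).trans hm) hm ht rfl rfl

/-- The structure square of a composite companion is diagonal; interchange against the identities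
off the diagonal straightens it into two columns. -/
theorem Companion.etaWhisker_comp {A A₁ B C : D.Obj} {a : D.V A₁ B} {b : D.V B C}
    (c : D.Companion a) (d : D.Companion b) (l : D.V A A₁) :
    (c.comp d).etaWhisker l ≍ D.hC (c.etaWhisker l) (d.etaWhisker (D.vcomp l a)) := by
  have h1 := c.etaWhisker_heq l
  have h2 := d.etaWhisker_heq (D.vcomp l a)
  have h3 := (c.comp d).etaWhisker_heq l
  have h4 : (c.comp d).η ≍ D.vC (D.hC c.η (D.hId a)) (D.hC (D.vId c.hat) d.η) := by
    exact D.cast_heq (D.hid_hcomp _) (D.vid_vcomp _) rfl rfl _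
  have h5 := D.vC_assoc (D.hC (D.hId l) (D.hId l)) (D.hC c.η (D.hId a)) (D.hC (D.vId c.hat) d.η)
  have h6 := D.interchange (D.hId l) (D.hId l) c.η (D.hId a)
  have h7 := D.interchange (D.vC (D.hId l) c.η) (D.vC (D.hId l) (D.hId a)) (D.vId c.hat) d.η
  have h8 := D.hId_vcomp l a
  have h9 := D.vC_vId (D.vC (D.hId l) c.η)
  have h10 := D.hId_hC (D.hId l)
  have e1 := D.vcomp_vid l
  have e3 := D.vcomp_vid (D.vcomp l a)
  have e4 := D.hid_hcomp (D.hid A)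
  have e5 := D.hid_hcomp (D.hid A₁)
  have e10 := D.vid_vcomp (D.vid A₁)
  have e11 : (c.comp d).hat = D.hcomp c.hat d.hat := rfl
  grind only

theorem Companion.epsWhisker_comp {A B C C₁ : D.Obj} {a : D.V A B} {b : D.V B C}
    (c : D.Companion a) (d : D.Companion b) (r : D.V C C₁) :
    (c.comp d).epsWhisker r ≍ D.hC (c.epsWhisker (D.vcomp b r)) (d.epsWhisker r) := by
  have h1 := c.epsWhisker_heq (D.vcomp b r)
  have h2 := d.epsWhisker_heq r
  have h3 := (c.comp d).epsWhisker_heq r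
  have h4 : (c.comp d).ε ≍ D.vC (D.hC c.ε (D.vId d.hat)) (D.hC (D.hId b) d.ε) := by
    exact D.cast_heq rfl rfl (D.vid_vcomp _) (D.hid_hcomp _) _
  have h5 := D.vC_assoc (D.hC c.ε (D.vId d.hat)) (D.hC (D.hId b) d.ε)
    (D.hC (D.hId r) (D.hId r))
  have h6 := D.interchange (D.hId b) d.ε (D.hId r) (D.hId r)
  have h7 := D.interchange c.ε (D.vId d.hat) (D.vC (D.hId b) (D.hId r)) (D.vC d.ε (D.hId r))
  have h8 := D.hId_vcomp b r
  have h9 := D.vId_vC (D.vC d.ε (D.hId r))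
  have h10 := D.hId_hC (D.hId r)
  have e1 := D.vid_vcomp r
  have e3 := D.vid_vcomp (D.vcomp b r)
  have e5 := D.hid_hcomp (D.hid C)
  have e6 := D.hid_hcomp (D.hid C₁)
  have e10 := D.vid_vcomp (D.vid C)
  have e11 : (c.comp d).hat = D.hcomp c.hat d.hat := rfl
  grind only

/-- Both sides equal the vertical composite of `c.epsWhisker m` with η of `d`: an ε-column and an
η-column slide past each other by interchange with identities. The square `z` is the whiskered ε
with its left side reassociated. -/
theorem Companion.epsWhisker_hC_etaWhisker {A B B' C : D.Obj} {a : D.V A B} {b : D.V B' C}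
    (c : D.Companion a) (d : D.Companion b) (m : D.V B B')
    {z : D.Sq c.hat (D.vcomp (D.vcomp a m) b) (D.vcomp m b) (D.hid C)}
    (hz : z ≍ c.epsWhisker (D.vcomp m b)) :
    D.hC (c.epsWhisker m) (d.etaWhisker m) ≍ D.hC (d.etaWhisker (D.vcomp a m)) z := by
  have h1 := D.interchange (c.epsWhisker m) (D.hId m) (D.hId (D.vid B')) (d.etaWhisker (D.vid B'))
  have h2 := D.interchange (D.hId (D.vcomp a m)) (c.epsWhisker m) (d.etaWhisker (D.vid B'))
    (D.hId (D.vcomp (D.vid B') b))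
  have h3 := d.hId_vC_etaWhisker m (D.vid B')
  have h4 := d.hId_vC_etaWhisker (D.vcomp a m) (D.vid B')
  have h5 := c.epsWhisker_vC_hId m (D.vcomp (D.vid B') b)
  have h6 := D.hC_hId (c.epsWhisker m)
  have h7 := D.hId_hC (c.epsWhisker m)
  have h8 := D.hId_hC (d.etaWhisker (D.vid B'))
  have h9 := D.hC_hId (d.etaWhisker (D.vid B'))
  have h10 := D.vC_vId (c.epsWhisker m)
  have h11 := D.hId_vid B'
  have e1 := D.vid_vcomp b
  have e2 := D.vcomp_vid m
  have e3 := D.vcomp_vid (D.vcomp a m)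
  have e4 := D.hcomp_hid c.hat
  have e5 := D.hid_hcomp c.hat
  have e6 := D.hcomp_hid d.hat
  have e7 := D.hid_hcomp d.hat
  grind only

/-! ### Comparison squares and transposes -/

/-- The square `[Id^l / η | ε / Id^m]` between companions. -/
def comparison {A A' B B' : D.Obj} {a : D.V A B} {b : D.V A' B'} (c : D.Companion a)
    (d : D.Companion b) (l : D.V A A') (m : D.V B B') (h : D.vcomp l b = D.vcomp a m) :
    D.Sq c.hat l m d.hat :=
  D.cast (D.hid_hcomp _) rfl rfl (D.hcomp_hid _)
    (D.hC (d.etaWhisker l) (D.cast rfl h.symm rfl rfl (c.epsWhisker m)))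

theorem comparison_heq {A A' B B' : D.Obj} {a : D.V A B} {b : D.V A' B'} (c : D.Companion a)
    (d : D.Companion b) (l : D.V A A') (m : D.V B B') (h : D.vcomp l b = D.vcomp a m)
    {x : D.Sq c.hat (D.vcomp l b) m (D.hid B')} (hx : x ≍ c.epsWhisker m) :
    comparison c d l m h ≍ D.hC (d.etaWhisker l) x := by
  obtain rfl : x = D.cast rfl h.symm rfl rfl (c.epsWhisker m) :=
    eq_of_heq (hx.trans (D.cast_heq ..).symm)
  exact D.cast_heq ..

/-- The transpose `[η | x | ε]` of a square along companions of its vertical sides. -/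
def transpose {A B A' B' : D.Obj} {f : D.H A B} {a : D.V A A'} {b : D.V B B'} {g : D.H A' B'}
    (c : D.Companion a) (d : D.Companion b) (x : D.Sq f a b g) :
    D.Glob (D.hcomp f d.hat) (D.hcomp c.hat g) :=
  D.cast (congrArg (D.hcomp · d.hat) (D.hid_hcomp _)) rfl rfl (D.hcomp_hid _)
    (D.hC (D.hC c.η x) d.ε)

theorem transpose_heq {A B A' B' : D.Obj} {f : D.H A B} {a : D.V A A'} {b : D.V B B'}
    {g : D.H A' B'} (c : D.Companion a) (d : D.Companion b) (x : D.Sq f a b g) :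
    transpose c d x ≍ D.hC (D.hC c.η x) d.ε :=
  D.cast_heq ..

theorem comparison_self {A B : D.Obj} {a : D.V A B} (c : D.Companion a)
    (h : D.vcomp (D.vid A) a = D.vcomp a (D.vid B)) :
    comparison c c (D.vid A) (D.vid B) h ≍ D.vId c.hat := by
  obtain ⟨x, hx⟩ := exists_heq (c.epsWhisker (D.vid B)) rfl h rfl rfl
  have h1 := comparison_heq c c _ _ h hx
  have h2 := c.etaWhisker_vid
  have h3 := c.epsWhisker_vid
  have h4 := c.hC_η_ε
  have e1 := D.vid_vcomp a
  grind only

theorem transpose_hId {A B : D.Obj} {a : D.V A B} (c : D.Companion a) :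
    transpose c c (D.hId a) ≍ D.vId c.hat := by
  have h1 := transpose_heq c c (D.hId a)
  have h2 := D.hC_hId c.η
  have h4 := c.hC_η_ε
  have e1 := D.hid_hcomp (D.hid A)
  have e2 := D.hcomp_hid c.hat
  grind only

/-- Pad the rows with identities to Id^l, η_b, ε_a over η_e, ε_b, Id^{m'}. The middle column η_b /
ε_b cancels, and the outer columns merge into the whiskered η_e and ε_a. -/
theorem comparison_vC_comparison {A A' A'' B B' B'' : D.Obj} {a : D.V A B} {b : D.V A' B'}
    {e : D.V A'' B''} (ca : D.Companion a) (cb : D.Companion b) (ce : D.Companion e)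
    (l : D.V A A') (m : D.V B B') (l' : D.V A' A'') (m' : D.V B' B'')
    (h : D.vcomp l b = D.vcomp a m) (h' : D.vcomp l' e = D.vcomp b m')
    (h'' : D.vcomp (D.vcomp l l') e = D.vcomp a (D.vcomp m m')) :
    D.vC (comparison ca cb l m h) (comparison cb ce l' m' h')
      ≍ comparison ca ce (D.vcomp l l') (D.vcomp m m') h'' := by
  -- These copies differ from the whiskered squares only in a side rewritten by `h`, `h'`, `h''` or
  -- associativity, so that neighbouring columns fit.
  obtain ⟨x, hx⟩ := exists_heq (ca.epsWhisker m) rfl h rfl rfl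
  obtain ⟨x', hx'⟩ := exists_heq (cb.epsWhisker m') rfl h' rfl rfl
  obtain ⟨x'', hx''⟩ := exists_heq (ca.epsWhisker (D.vcomp m m')) rfl h'' rfl rfl
  obtain ⟨p', hp'⟩ := exists_heq (ce.etaWhisker l') rfl rfl h'.symm rfl
  obtain ⟨p'', hp''⟩ := exists_heq (ce.etaWhisker (D.vcomp l l')) rfl rfl
    (show D.vcomp l (D.vcomp b m') = _ by rw [← h', D.vcomp_assoc]) rfl
  obtain ⟨y, hy⟩ := exists_heq (ca.epsWhisker (D.vcomp m m')) rfl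
    (show D.vcomp l (D.vcomp b m') = _ by rw [← h', ← D.vcomp_assoc, h'']) rfl rfl
  have k1 := comparison_heq ca cb l m h hx
  have k2 := comparison_heq cb ce l' m' h' hx'
  have k3 := comparison_heq ca ce _ _ h'' hx''
  have k4 := ce.hId_vC_etaWhisker l l'
  have k5 := ca.epsWhisker_vC_hId m m'
  have e1 := D.hid_hcomp (D.hid A)
  have e4 := D.hid_hcomp ca.hat
  have e5 := D.hid_hcomp cb.hat
  have e6 := D.hcomp_hid cb.hat
  have e7 := D.hcomp_hid ce.hat
  have e8 := D.vcomp_assoc l b m'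
  have e9 := D.vcomp_assoc a m m'
  have k6 : D.vC (D.hId l) p' ≍ p'' := by grind only
  have k7 : D.vC x (D.hId m') ≍ y := by grind only
  have z := cb.zigzag (D.hId l) x p' (D.hId m') k6 k7 rfl rfl rfl
  have k8 := D.hId_hC (cb.etaWhisker l)
  have k9 := D.hC_hId (cb.epsWhisker m')
  have k10 := D.hC_assoc p' (cb.epsWhisker m') (D.hId m')
  have e13 := D.hcomp_hid (D.hid B'')
  grind only

/-- The four columns are η_b, ε_a, η_{b'}, ε_{a'}. Sliding the middle two past each other groups the
η's and the ε's into those of the composite companions. -/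
theorem comparison_hC_comparison {A A' B B' C C' : D.Obj} {a : D.V A B} {a' : D.V B C}
    {b : D.V A' B'} {b' : D.V B' C'} (ca : D.Companion a) (ca' : D.Companion a')
    (cb : D.Companion b) (cb' : D.Companion b') (l : D.V A A') (m : D.V B B') (r : D.V C C')
    (h : D.vcomp l b = D.vcomp a m) (h' : D.vcomp m b' = D.vcomp a' r)
    (h'' : D.vcomp l (D.vcomp b b') = D.vcomp (D.vcomp a a') r) :
    D.hC (comparison ca cb l m h) (comparison ca' cb' m r h')
      ≍ comparison (ca.comp ca') (cb.comp cb') l r h'' := by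
  obtain ⟨x, hx⟩ := exists_heq (ca.epsWhisker m) rfl h rfl rfl
  obtain ⟨x', hx'⟩ := exists_heq (ca'.epsWhisker r) rfl h' rfl rfl
  obtain ⟨x'', hx''⟩ := exists_heq ((ca.comp ca').epsWhisker r) rfl h'' rfl rfl
  have k1 := comparison_heq ca cb l m h hx
  have k2 := comparison_heq ca' cb' m r h' hx'
  have k3 := comparison_heq (ca.comp ca') (cb.comp cb') l r h'' hx''
  have k4 := cb.etaWhisker_comp cb' l
  have k5 := ca.epsWhisker_comp ca' r
  have e0 : D.vcomp (D.vcomp a m) b' = D.vcomp a (D.vcomp m b') := D.vcomp_assoc a m b'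
  have e0' : D.vcomp l (D.vcomp b b') = D.vcomp (D.vcomp l b) b' := (D.vcomp_assoc ..).symm
  obtain ⟨z, hz⟩ := exists_heq (ca.epsWhisker (D.vcomp m b')) rfl e0 rfl rfl
  obtain ⟨w, hw⟩ := exists_heq z rfl (show D.vcomp (D.vcomp l b) b' = _ by rw [h]) rfl rfl
  have k6 := ca.epsWhisker_hC_etaWhisker cb' m hz
  have k7 := D.hC_assoc (cb.etaWhisker l) (cb'.etaWhisker (D.vcomp l b)) w
  have k8 := D.hC_assoc (cb.etaWhisker l) (D.hC (cb'.etaWhisker (D.vcomp l b)) w) x'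
  have k9 := D.hC_assoc (D.hC (cb.etaWhisker l) (cb'.etaWhisker (D.vcomp l b))) w x'
  have k10 := D.hC_assoc (cb.etaWhisker l) x (D.hC (cb'.etaWhisker m) x')
  have k11 := D.hC_assoc x (cb'.etaWhisker m) x'
  have e1 := D.hid_hcomp ca.hat
  have e2 := D.hid_hcomp ca'.hat
  have e3 := D.hcomp_hid cb.hat
  have e4 := D.hcomp_hid cb'.hat
  have e5 : (ca.comp ca').hat = D.hcomp ca.hat ca'.hat := rfl
  have e6 : (cb.comp cb').hat = D.hcomp cb.hat cb'.hat := rfl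
  have e7 := D.hcomp_hid ca.hat
  have e8 := D.hid_hcomp cb'.hat
  have e9 := D.hid_hcomp (D.hid A)
  have e10 := D.hcomp_hid (D.hid C')
  have e12 := D.hcomp_hid (D.hcomp cb.hat cb'.hat)
  grind only

/-- The square `[Id^l / η | x | ε / Id^r]`. -/
def transposeWhisker {A A₁ A' B B₁ B' : D.Obj} {f : D.H A B} {l : D.V A A₁} {a : D.V A₁ A'}
    {b : D.V B B₁} {r : D.V B₁ B'} {g : D.H A' B'}
    (c : D.Companion a) (d : D.Companion b) (x : D.Sq f (D.vcomp l a) (D.vcomp b r) g) :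
    D.Sq (D.hcomp f d.hat) l r (D.hcomp c.hat g) :=
  D.cast (congrArg (D.hcomp · d.hat) (D.hid_hcomp _)) rfl rfl (D.hcomp_hid _)
    (D.hC (D.hC (c.etaWhisker l) x) (d.epsWhisker r))

theorem transposeWhisker_heq {A A₁ A' B B₁ B' : D.Obj} {f : D.H A B} {l : D.V A A₁}
    {a : D.V A₁ A'} {b : D.V B B₁} {r : D.V B₁ B'} {g : D.H A' B'}
    (c : D.Companion a) (d : D.Companion b) (x : D.Sq f (D.vcomp l a) (D.vcomp b r) g) :
    transposeWhisker c d x ≍ D.hC (D.hC (c.etaWhisker l) x) (d.epsWhisker r) :=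
  D.cast_heq ..

/-- One half of naturality: η_d of the comparison lies above ε_d of the transpose, and this pair
cancels, leaving `p` stacked on `y`. -/
theorem hC_comparison_vC_transpose {A A' A'' B B' C C' : D.Obj} {f : D.H A B} {g : D.H A' B'}
    {h : D.H A'' C'} {k : D.V A A'} {l : D.V B B'} {b : D.V B C} {d : D.V B' C'} {r : D.V C C'}
    {e : D.V A' A''} (cb : D.Companion b) (cd : D.Companion d) (ce : D.Companion e)
    (p : D.Sq f k l g) (y : D.Sq g e d h) (hl : D.vcomp l d = D.vcomp b r)
    {x : D.Sq f (D.vcomp k e) (D.vcomp b r) h} (hx : D.vC p y ≍ x) :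
    D.vC (D.hC p (comparison cb cd l r hl)) (transpose ce cd y) ≍ transposeWhisker ce cb x := by
  obtain ⟨q, hq⟩ := exists_heq (cb.epsWhisker r) rfl hl rfl rfl
  have e0 : D.vcomp l (D.vcomp d (D.vid _)) = D.vcomp b r := by rw [D.vcomp_vid, hl]
  obtain ⟨p', hp'⟩ := exists_heq (D.hC ce.η y) rfl rfl (D.vcomp_vid d) rfl
  obtain ⟨x', hx'⟩ := exists_heq (D.hC (ce.etaWhisker k) x) rfl (D.vcomp_vid k) e0 rfl
  obtain ⟨y', hy'⟩ := exists_heq (cb.epsWhisker r) rfl e0 (D.vcomp_vid r) rfl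
  have e1 := D.hid_hcomp f
  have e2 := D.hid_hcomp g
  have e3 := D.hid_hcomp cb.hat
  have e4 := D.hcomp_hid cd.hat
  have e5 := D.vcomp_vid k
  have e6 := D.vcomp_vid r
  have e7 := D.vcomp_vid d
  have k1 := comparison_heq cb cd l r hl hq
  have k2 := transpose_heq ce cd y
  have k3 := transposeWhisker_heq ce cb x
  have k4 := D.interchange (D.hId k) p ce.η y
  have k5 := ce.etaWhisker_heq k
  have k6 := D.vC_vId q
  have k7 := D.hId_vid C'
  have k8 := D.hId_hC p
  have k9 := cd.epsWhisker_vid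
  have k10 : D.vC (D.hC (D.hId k) p) p' ≍ x' := by grind only
  have k11 : D.vC q (D.hId (D.vid C')) ≍ y' := by grind only
  have z := cd.zigzag (D.hC (D.hId k) p) q p' (D.hId (D.vid C')) k10 k11 rfl rfl rfl
  have k12 := D.hC_assoc p (cd.etaWhisker l) q
  have k13 := D.hC_hId (D.hC p' (cd.epsWhisker (D.vid C')))
  have e8 := D.hcomp_hid (D.hcomp ce.hat h)
  have e10 := D.hcomp_assoc f (D.hid B) cb.hat
  have e11 := D.hcomp_assoc g cd.hat (D.hid C')
  grind only

/-- The other half: now η_e of the transpose lies above ε_e of the comparison. -/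
theorem transpose_vC_hC_comparison {A A' A₁ B B' C C' : D.Obj} {f : D.H A B} {g : D.H A' B'}
    {h : D.H C C'} {k : D.V A A₁} {m : D.V A' C} {r : D.V B' C'} {b : D.V B B'} {e : D.V A A'}
    {d : D.V A₁ C} (cb : D.Companion b) (cd : D.Companion d) (ce : D.Companion e)
    (y : D.Sq f e b g) (p : D.Sq g m r h) (hm : D.vcomp k d = D.vcomp e m)
    {x : D.Sq f (D.vcomp k d) (D.vcomp b r) h} (hx : D.vC y p ≍ x) :
    D.vC (transpose ce cb y) (D.hC (comparison ce cd k m hm) p) ≍ transposeWhisker cd cb x := by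
  obtain ⟨q, hq⟩ := exists_heq (ce.epsWhisker m) rfl hm rfl rfl
  obtain ⟨w, hw⟩ := exists_heq (D.hC y cb.ε) rfl (D.vid_vcomp e) rfl rfl
  have e0 : D.vcomp (D.vid A) (D.vcomp e m) = D.vcomp k d := by rw [D.vid_vcomp, hm]
  obtain ⟨p', hp'⟩ := exists_heq (cd.etaWhisker k) rfl rfl hm.symm rfl
  obtain ⟨x', hx'⟩ := exists_heq (cd.etaWhisker k) rfl (D.vid_vcomp k) e0 rfl
  obtain ⟨y', hy'⟩ := exists_heq (D.hC x (cb.epsWhisker r)) rfl e0 (D.vid_vcomp r) rfl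
  have e1 := D.hcomp_hid g
  have e2 := D.hcomp_hid h
  have e3 := D.hid_hcomp ce.hat
  have e4 := D.hcomp_hid cd.hat
  have e5 := D.vid_vcomp k
  have e6 := D.vid_vcomp r
  have e7 := D.vid_vcomp e
  have k1 := comparison_heq ce cd k m hm hq
  have k2 := transpose_heq ce cb y
  have k3 := transposeWhisker_heq cd cb x
  have k4 := D.interchange y cb.ε p (D.hId r)
  have k5 := cb.epsWhisker_heq r
  have k6 := D.vId_vC p'
  have k7 := D.hId_vid A
  have k8 := D.hC_hId p
  have k9 := ce.etaWhisker_vid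
  have k10 : D.vC (D.hId (D.vid A)) p' ≍ x' := by grind only
  have k11 : D.vC w (D.hC p (D.hId r)) ≍ y' := by grind only
  have z := ce.zigzag (D.hId (D.vid A)) w p' (D.hC p (D.hId r)) k10 k11 rfl rfl rfl
  have k13 := D.hId_hC (ce.etaWhisker (D.vid A))
  have k15 := D.hC_assoc ce.η y cb.ε
  have k16 := D.hC_assoc (cd.etaWhisker k) x (cb.epsWhisker r)
  have e8 := D.hid_hcomp (D.hid A)
  have e10 := D.hcomp_assoc (D.hid A) f cb.hat
  have e12 := D.hid_hcomp f
  grind only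

/-- Naturality of transposition against the comparison squares of the companions. -/
theorem transpose_naturality {A A' A₁ A'' B B' B₁ B'' : D.Obj} {f : D.H A B} {g : D.H A₁ B₁}
    {f' : D.H A' B'} {g' : D.H A'' B''} {k : D.V A A₁} {l : D.V B B₁} {m : D.V A' A''}
    {r : D.V B' B''} {a : D.V A A'} {a₁ : D.V A₁ A''} {b : D.V B B'} {b₁ : D.V B₁ B''}
    (ca : D.Companion a) (ca₁ : D.Companion a₁) (cb : D.Companion b) (cb₁ : D.Companion b₁)
    (p : D.Sq f k l g) (y : D.Sq g a₁ b₁ g') (y' : D.Sq f a b f') (p' : D.Sq f' m r g')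
    (ha : D.vcomp k a₁ = D.vcomp a m) (hb : D.vcomp l b₁ = D.vcomp b r)
    (h : D.vC p y ≍ D.vC y' p') :
    D.vC (D.hC p (comparison cb cb₁ l r hb)) (transpose ca₁ cb₁ y)
      ≍ D.vC (transpose ca cb y') (D.hC (comparison ca ca₁ k m ha) p') := by
  -- Both sides equal the whiskered transpose of this one stacked square, by `h`.
  obtain ⟨x, hx⟩ := exists_heq (D.vC p y) rfl rfl hb.symm rfl
  exact (hC_comparison_vC_transpose cb cb₁ ca₁ p y hb hx.symm).trans
    (transpose_vC_hC_comparison cb ca₁ ca y' p' ha (h.symm.trans hx.symm)).symm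

/-- The inner pair η_b over ε_b cancels. This is the source of the compositor axiom; `w` only
carries the reassociated top. -/
theorem hC_transpose_vC_hC_transpose {A A' B B' C C' : D.Obj} {f : D.H A B} {f' : D.H B C}
    {g : D.H A' B'} {g' : D.H B' C'} {a : D.V A A'} {b : D.V B B'} {c : D.V C C'}
    (ca : D.Companion a) (cb : D.Companion b) (cc : D.Companion c)
    (x : D.Sq f a b g) (y : D.Sq f' b c g')
    {w : D.Glob (D.hcomp f (D.hcomp cb.hat g')) (D.hcomp (D.hcomp ca.hat g) g')}
    (hw : w ≍ D.hC (transpose ca cb x) (D.vId g')) :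
    D.vC (D.hC (D.vId f) (transpose cb cc y)) w ≍ transpose ca cc (D.hC x y) := by
  have e0 : D.vcomp (D.vid B) (D.vcomp b (D.vid B')) = b := by rw [D.vid_vcomp, D.vcomp_vid]
  obtain ⟨q, hq⟩ := exists_heq (D.hC y cc.ε) rfl (D.vid_vcomp b) rfl rfl
  obtain ⟨p', hp'⟩ := exists_heq (D.hC ca.η x) (D.hid_hcomp f).symm rfl (D.vcomp_vid b) rfl
  obtain ⟨x', hx'⟩ := exists_heq (D.hC ca.η x) (D.hid_hcomp f).symm rfl e0 rfl
  obtain ⟨y', hy'⟩ := exists_heq (D.hC y cc.ε) rfl e0 rfl rfl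
  have e1 := D.hid_hcomp f
  have e4 := D.hcomp_hid g'
  have e6 := D.vcomp_vid b
  have k1 := transpose_heq ca cb x
  have k2 := transpose_heq cb cc y
  have k3 := transpose_heq ca cc (D.hC x y)
  have k4 := cb.etaWhisker_vid
  have k5 := cb.epsWhisker_vid
  have k6 : D.vC (D.vId f) p' ≍ x' := (D.vId_vC p').trans (hp'.trans hx'.symm)
  have k7 : D.vC q (D.vId (D.hcomp g' (D.hid C'))) ≍ y' :=
    (D.vC_vId q).trans (hq.trans hy'.symm)
  have z := cb.zigzag (D.vId f) q p' (D.vId (D.hcomp g' (D.hid C'))) k6 k7 (D.vid_vcomp _) rfl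
    (D.vid_vcomp _)
  have k8 := D.hC_assoc (D.vId f) (cb.etaWhisker (D.vid B)) q
  have k9 := D.hC_assoc cb.η y cc.ε
  have k11 := D.hC_assoc (D.hC ca.η x) y cc.ε
  have k12 := D.hC_assoc ca.η x y
  have e7 := D.hcomp_assoc f (D.hid B) (D.hcomp f' cc.hat)
  have e8 := D.hcomp_assoc (D.hid B) f' cc.hat
  have e9 := D.hcomp_assoc ca.hat g g'
  have e11 := D.hid_hcomp f'
  have e12 := D.hid_hcomp (D.hcomp f f')
  have e16 := D.hcomp_hid (D.hcomp ca.hat g)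
  have e18 := D.hcomp_assoc f cb.hat g'
  grind only

/-- No cancellation occurs: η and ε of the composite companions are two-row diagonals, and
interchange splits the transpose of x / y into a row for `x` and a row for `y`. -/
theorem transpose_comp {A A' A'' B B' B'' : D.Obj} {f : D.H A B} {g : D.H A' B'}
    {h : D.H A'' B''} {a : D.V A A'} {b : D.V B B'} {a' : D.V A' A''} {b' : D.V B' B''}
    (ca : D.Companion a) (cb : D.Companion b) (ca' : D.Companion a') (cb' : D.Companion b')
    (x : D.Sq f a b g) (y : D.Sq g a' b' h)
    {p : D.Sq (D.hcomp f (D.hcomp cb.hat cb'.hat)) (D.vid A) (D.vid B'')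
      (D.hcomp ca.hat (D.hcomp g cb'.hat))}
    {q : D.Sq (D.hcomp ca.hat (D.hcomp g cb'.hat)) (D.vid A) (D.vid B'')
      (D.hcomp (D.hcomp ca.hat ca'.hat) h)}
    (hp : p ≍ D.hC (transpose ca cb x) (D.vId cb'.hat))
    (hq : q ≍ D.hC (D.vId ca.hat) (transpose ca' cb' y)) :
    D.gcomp p q = transpose (ca.comp ca') (cb.comp cb') (D.vC x y) := by
  have k0 : D.gcomp p q ≍ D.vC p q := D.cast_heq ..
  have k1 := transpose_heq ca cb x
  have k2 := transpose_heq ca' cb' y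
  have k3 := transpose_heq (ca.comp ca') (cb.comp cb') (D.vC x y)
  have h4 : (ca.comp ca').η ≍ D.vC (D.hC ca.η (D.hId a)) (D.hC (D.vId ca.hat) ca'.η) := by
    exact D.cast_heq (D.hid_hcomp _) (D.vid_vcomp _) rfl rfl _
  have h5 : (cb.comp cb').ε ≍ D.vC (D.hC cb.ε (D.vId cb'.hat)) (D.hC (D.hId b') cb'.ε) := by
    exact D.cast_heq rfl rfl (D.vid_vcomp _) (D.hid_hcomp _) _
  have k4 := D.interchange (D.hC ca.η (D.hId a)) x (D.hC (D.vId ca.hat) ca'.η) y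
  have k5 := D.interchange (D.hC (D.hC ca.η (D.hId a)) x) (D.hC cb.ε (D.vId cb'.hat))
    (D.hC (D.hC (D.vId ca.hat) ca'.η) y) (D.hC (D.hId b') cb'.ε)
  have k6 := D.hC_hId ca.η
  have k7 := D.hId_hC cb'.ε
  have k8 := D.hC_assoc (D.hC ca.η x) cb.ε (D.vId cb'.hat)
  have k9 := D.hC_assoc (D.vId ca.hat) (D.hC ca'.η y) cb'.ε
  have k10 := D.hC_assoc (D.vId ca.hat) ca'.η y
  have e1 := D.hid_hcomp f
  have e2 := D.hid_hcomp g
  have e4 := D.hcomp_hid h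
  have e5 := D.hid_hcomp (D.hid A)
  have e6 := D.hcomp_hid ca.hat
  have e7 := D.hid_hcomp cb'.hat
  have e8 := D.hid_hcomp (D.hid B'')
  have e10 := D.hcomp_assoc ca.hat g cb'.hat
  have e11 := D.hcomp_assoc ca.hat ca'.hat h
  have e14 := D.hcomp_assoc (D.hcomp ca.hat ca'.hat) h (D.hid B'')
  have e15 := D.vid_vcomp (D.vid A)
  have e16 := D.vid_vcomp (D.vid B'')
  have e17 : (ca.comp ca').hat = D.hcomp ca.hat ca'.hat := rfl
  have e18 : (cb.comp cb').hat = D.hcomp cb.hat cb'.hat := rfl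
  have e22 := D.hcomp_hid (D.hcomp ca.hat g)
  have e23 := D.hcomp_hid (D.hcomp ca'.hat h)
  apply eq_of_heq
  grind only

/-! ### The bijection, comparison cells and coherence -/

/-- The inverse `η / y / ε` of `DblCat.lift`. -/
def unlift {A B : D.Obj} {u v : D.V A B} (c : D.Companion u) (d : D.Companion v)
    (y : D.Glob d.hat c.hat) : D.VGlob u v :=
  D.cast rfl ((congrArg (D.vcomp · u) (D.vid_vcomp _)).trans (D.vid_vcomp _))
    ((D.vcomp_vid _).trans (D.vcomp_vid _)) rfl (D.vC (D.vC d.η y) c.ε)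

theorem unlift_heq {A B : D.Obj} {u v : D.V A B} (c : D.Companion u) (d : D.Companion v)
    (y : D.Glob d.hat c.hat) : unlift c d y ≍ D.vC (D.vC d.η y) c.ε :=
  D.cast_heq ..

theorem lift_heq {A B : D.Obj} {u v : D.V A B} (c : D.Companion u) (d : D.Companion v)
    (x : D.VGlob u v) : D.lift c d x ≍ D.hC (D.hC c.η x) d.ε :=
  D.cast_heq ..

/-- First η_v / ε_v = Id^v reduces η_v over the lift to [η_u | x]; then η_u / ε_u = Id^u leaves x.
-/
theorem unlift_lift {A B : D.Obj} {u v : D.V A B} (c : D.Companion u) (d : D.Companion v)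
    (x : D.VGlob u v) : unlift c d (D.lift c d x) = x := by
  have k1 := unlift_heq c d (D.lift c d x)
  have k2 := lift_heq c d x
  have k3 := D.interchange (D.vId (D.hcomp (D.hid A) (D.hid A))) d.η (D.hC c.η x) d.ε
  have k4 := D.interchange c.η x c.ε (D.vId (D.hid B))
  have k6 := D.hId_vid A
  have k7 := D.hId_vid B
  have k9 := D.hId_hC d.η
  have k10 := D.vId_vC (D.hC c.η x)
  have k11 := d.vC_η_ε
  have k12 := c.vC_η_ε
  have k13 := D.hC_hId (D.hC c.η x)
  have k14 := D.hC_hId c.ε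
  have k15 := D.vC_vId x
  have k16 := D.hId_hC x
  have e1 := D.hid_hcomp (D.hid A)
  have e2 := D.hid_hcomp (D.hid B)
  have e3 := D.hid_hcomp d.hat
  have e4 := D.hcomp_hid c.hat
  have e5 := D.vid_vcomp (D.vid A)
  have e6 := D.vcomp_vid v
  have e7 := D.vid_vcomp u
  have e8 := D.vid_vcomp v
  have e9 := D.vcomp_vid u
  apply eq_of_heq
  grind only

/-- The same argument with rows and columns exchanged, now using [η | ε] = Id for both companions.
-/
theorem lift_unlift {A B : D.Obj} {u v : D.V A B} (c : D.Companion u) (d : D.Companion v)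
    (y : D.Glob d.hat c.hat) : D.lift c d (unlift c d y) = y := by
  have k1 := unlift_heq c d y
  have k2 := lift_heq c d (unlift c d y)
  have k3 := D.interchange (D.hId (D.vcomp (D.vid A) (D.vid A))) (D.vC d.η y) c.η c.ε
  have k4 := D.interchange d.η d.ε y (D.vId (D.hid B))
  have k5 := D.hId_vid A
  have k6 := D.hId_vid B
  have k7 := D.hId_hC (D.vC d.η y)
  have k8 := D.vId_vC c.η
  have k9 := D.vC_vId (D.vC d.η y)
  have k10 := D.vC_vId d.ε
  have k11 := D.hC_hId y
  have k12 := D.vId_vC y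
  have k13 := c.hC_η_ε
  have k14 := d.hC_η_ε
  have e1 := D.hid_hcomp (D.hid A)
  have e3 := D.hid_hcomp d.hat
  have e4 := D.hcomp_hid c.hat
  have e5 := D.vid_vcomp (D.vid A)
  have e6 := D.vcomp_vid v
  have e7 := D.vid_vcomp u
  have e9 := D.vid_vcomp (D.vid B)
  have e10 := D.hid_hcomp c.hat
  have e11 := D.hcomp_hid d.hat
  apply eq_of_heq
  grind only

theorem lift_bijective {A B : D.Obj} {u v : D.V A B} (c : D.Companion u) (d : D.Companion v) :
    Function.Bijective (D.lift c d) :=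
  Function.bijective_iff_has_inverse.2 ⟨unlift c d, unlift_lift c d, lift_unlift c d⟩

/-- The comparison cell between two companions of the same 1v-cell. -/
def companionComparison {A B : D.Obj} {u v : D.V A B} (c : D.Companion u) (d : D.Companion v)
    (h : u = v) : D.Glob c.hat d.hat :=
  comparison c d (D.vid A) (D.vid B) (by rw [D.vid_vcomp, D.vcomp_vid, h])

theorem lift_eq_companionComparison {A B : D.Obj} {u v : D.V A B} (c : D.Companion u)
    (d : D.Companion v) (h : u = v) {x : D.VGlob u v} (hx : x ≍ D.hId u) :
    D.lift c d x = companionComparison d c h.symm := by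
  subst h
  obtain ⟨y, hy⟩ := exists_heq (d.epsWhisker (D.vid B)) rfl
    (show D.vcomp (D.vid A) u = _ by rw [D.vid_vcomp, D.vcomp_vid]) rfl rfl
  have k1 : companionComparison d c rfl ≍ D.hC (c.etaWhisker (D.vid A)) y :=
    comparison_heq d c (D.vid A) (D.vid B) _ hy
  have k2 := lift_heq c d x
  have k3 := c.etaWhisker_vid
  have k4 := d.epsWhisker_vid
  have k5 := D.hC_hId c.η
  have e1 := D.vid_vcomp u
  have e2 := D.hid_hcomp (D.hid A)
  have e3 := D.hcomp_hid c.hat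
  apply eq_of_heq
  grind only

theorem companionComparison_self {A B : D.Obj} {u : D.V A B} (c : D.Companion u) :
    companionComparison c c rfl = D.vId c.hat :=
  eq_of_heq (comparison_self c _)

theorem gcomp_companionComparison {A B : D.Obj} {u v w : D.V A B} (c : D.Companion u)
    (d : D.Companion v) (e : D.Companion w) (h : u = v) (h' : v = w) :
    D.gcomp (companionComparison c d h) (companionComparison d e h')
      = companionComparison c e (h.trans h') := by
  have hid : ∀ X, D.vcomp (D.vid X) (D.vid X) = D.vid X := fun X => D.vid_vcomp _
  subst h h'
  apply eq_of_heq
  refine (D.cast_heq ..).trans ((comparison_vC_comparison c d e (D.vid A) (D.vid B) (D.vid A)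
    (D.vid B) _ _ (by simp only [D.vid_vcomp, D.vcomp_vid])).trans ?_)
  unfold companionComparison
  congr 1 <;> first | exact hid _ | exact proof_irrel_heq _ _

theorem companionComparison_isGlobIso {A B : D.Obj} {u v : D.V A B} (c : D.Companion u)
    (d : D.Companion v) (h : u = v) : D.IsGlobIso (companionComparison c d h) := by
  subst h
  refine ⟨companionComparison d c rfl, ?_, ?_⟩ <;>
    rw [gcomp_companionComparison, companionComparison_self]

theorem hC_companionComparison {A B C : D.Obj} {u v : D.V A B} {u' v' : D.V B C}
    (c : D.Companion u) (d : D.Companion v) (c' : D.Companion u') (d' : D.Companion v')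
    (h : u = v) (h' : u' = v') :
    D.hC (companionComparison c d h) (companionComparison c' d' h')
      = companionComparison (c.comp c') (d.comp d') (by rw [h, h']) :=
  eq_of_heq (comparison_hC_comparison ..)

/-- The defining equation says that `unlift` of `x` is the identity, so the bijection determines `x`
as the lift of the identity. -/
theorem isComparison_iff {A B : D.Obj} (p q : D.CompanionPair A B) (h : p.vert = q.vert)
    (x : D.Glob p.hat q.hat) :
    D.IsComparison p q x ↔ x = companionComparison p.companion q.companion h := by
  -- The identity square, retyped to run from `q.vert` to `p.vert`.
  obtain ⟨i, hi⟩ := exists_heq (D.hId p.vert) rfl h.symm rfl rfl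
  have hi' : i ≍ D.hId q.vert := hi.trans (by rw [h])
  rw [← lift_eq_companionComparison q.companion p.companion h.symm hi']
  have k := unlift_heq q.companion p.companion x
  constructor
  · rintro ⟨-, hx⟩
    rw [← eq_of_heq (k.trans (hx.trans hi.symm)), lift_unlift]
  · rintro rfl
    exact ⟨h, k.symm.trans ((heq_of_eq (unlift_lift ..)).trans hi)⟩

/-- Comparison cells contain identities and are closed under both compositions, so a pasting depends
only on its source and target pairs. -/
theorem Pasting.eq_companionComparison {J : Type*} {s t : J → D.Obj}
    {dom cod : ∀ j, D.CompanionPair (s j) (t j)} {x : ∀ j, D.Glob (dom j).hat (cod j).hat}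
    (hx : ∀ j, ∃ h : (dom j).vert = (cod j).vert,
      x j = companionComparison (dom j).companion (cod j).companion h)
    {A B : D.Obj} {p q : D.CompanionPair A B} {y : D.Glob p.hat q.hat}
    (hy : D.Pasting dom cod x p q y) :
    ∃ h : p.vert = q.vert, y = companionComparison p.companion q.companion h := by
  induction hy with
  | of j => exact hx j
  | id p => exact ⟨rfl, (companionComparison_self _).symm⟩
  | vert _ _ iha ihb =>
    obtain ⟨h, rfl⟩ := iha
    obtain ⟨h', rfl⟩ := ihb
    exact ⟨h.trans h', gcomp_companionComparison ..⟩
  | @horiz A B C p q p' q' _ _ _ _ iha ihb =>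
    obtain ⟨h, rfl⟩ := iha
    obtain ⟨h', rfl⟩ := ihb
    exact ⟨congrArg₂ D.vcomp h h', hC_companionComparison ..⟩

end DblCat

theorem HorTransData.mk_congr {B D : DblCat} {F G : LaxFunctor B D}
    {app : ∀ X, D.H (F.obj X) (G.obj X)}
    {v v' : ∀ {X X' : B.Obj} (u : B.V X X'), D.Sq (app X) (F.mapV u) (G.mapV u) (app X')}
    {δ δ' : ∀ {X Y : B.Obj} (f : B.H X Y),
      D.Glob (D.hcomp (F.mapH f) (app Y)) (D.hcomp (app X) (G.mapH f))}
    (hv : ∀ {X X' : B.Obj} (u : B.V X X'), v u = v' u)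
    (hδ : ∀ {X Y : B.Obj} (f : B.H X Y), δ f = δ' f) :
    (⟨app, v, δ⟩ : HorTransData F G) = ⟨app, v', δ'⟩ := by
  obtain rfl : @v = @v' := by funext X X' u; exact hv u
  obtain rfl : @δ = @δ' := by funext X Y f; exact hδ f
  rfl

/-! ### Induced horizontal transformations -/

namespace VStrict

variable {B D : DblCat} {F G K : LaxFunctor B D}

theorem hat_vcell (α : VStrict F G) (c : ∀ X, D.Companion (α.app X)) {X X' : B.Obj}
    (u : B.V X X') : (α.hat c).vcell u =
      DblCat.comparison (c X) (c X') (F.mapV u) (G.mapV u) (α.nat u).symm := by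
  obtain ⟨x, hx⟩ := DblCat.exists_heq ((c X).epsWhisker (G.mapV u)) rfl (α.nat u).symm rfl rfl
  have k1 := DblCat.comparison_heq (c X) (c X') _ _ (α.nat u).symm hx
  have k2 := (c X).epsWhisker_heq (G.mapV u)
  have k3 := (c X').etaWhisker_heq (F.mapV u)
  have k4 := D.cast_heq rfl (α.nat u) rfl rfl (D.vC (c X).ε (D.hId (G.mapV u)))
  have k5 : (α.hat c).vcell u ≍ D.hC (D.vC (D.hId (F.mapV u)) (c X').η)
    (D.cast rfl (α.nat u) rfl rfl (D.vC (c X).ε (D.hId (G.mapV u)))) := D.cast_heq ..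
  have e2 := D.vcomp_vid (F.mapV u)
  have e3 := D.vid_vcomp (G.mapV u)
  apply eq_of_heq
  grind only

/-- The cells at 1v-cells agree by horizontal composition of comparison squares, the δ's by
`transpose_comp`. -/
theorem hat_comp (α : VStrict F G) (β : VStrict G K) (c : ∀ X, D.Companion (α.app X))
    (d : ∀ X, D.Companion (β.app X)) :
    (α.hat c).comp (β.hat d) = (α.comp β).hat fun X => (c X).comp (d X) := by
  refine HorTransData.mk_congr (fun u => ?_) (fun f => ?_)
  · refine Eq.trans ?_ (hat_vcell (α.comp β) (fun X => (c X).comp (d X)) u).symm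
    rw [hat_vcell, hat_vcell]
    exact eq_of_heq (DblCat.comparison_hC_comparison ..)
  · exact DblCat.transpose_comp (c _) (c _) (d _) (d _) (α.cell f) (β.cell f)
      (D.cast_heq ..) (D.cast_heq ..)

/-- The axioms involving δ transpose the corresponding axioms of `α`; vertical functoriality is that
of comparison squares. -/
theorem hat_isOplax (α : VStrict F G) (c : ∀ X, D.Companion (α.app X)) :
    (α.hat c).IsOplax where
  compositor {X Y Z} f g := by
    have k1 := DblCat.hC_transpose_vC_hC_transpose (c X) (c Y) (c Z) (α.cell f) (α.cell g)
      (w := D.cast (D.hcomp_assoc _ _ _) rfl rfl rfl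
        (D.hC ((α.hat c).δ f) (D.vId (G.mapH g)))) (D.cast_heq ..)
    have k2 := DblCat.transpose_naturality (c X) (c X) (c Z) (c Z) (F.compositor f g)
      (α.cell (B.hcomp f g)) (D.hC (α.cell f) (α.cell g)) (G.compositor f g)
      (by rw [D.vid_vcomp, D.vcomp_vid]) (by rw [D.vid_vcomp, D.vcomp_vid])
      (α.cell_compositor f g).symm
    -- Compositors have identity sides, so the comparison squares in the naturality identity
    -- degenerate to identities.
    have k3 := DblCat.comparison_self (c X) (by rw [D.vid_vcomp, D.vcomp_vid])
    have k4 := DblCat.comparison_self (c Z) (by rw [D.vid_vcomp, D.vcomp_vid])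
    rw [eq_of_heq k3, eq_of_heq k4] at k2
    exact k2.trans (D.vC_congr k1.symm (D.cast_heq ..).symm (D.hcomp_assoc _ _ _)
      (D.vid_vcomp _).symm (D.vid_vcomp _).symm (D.hcomp_assoc _ _ _).symm rfl rfl rfl)
  unitor X := by
    have k2 := DblCat.transpose_naturality (c X) (c X) (c X) (c X) (F.unitor X)
      (α.cell (B.hid X)) (D.hId (α.app X)) (G.unitor X)
      (by rw [D.vid_vcomp, D.vcomp_vid]) (by rw [D.vid_vcomp, D.vcomp_vid])
      (α.cell_unitor X)
    have k3 := DblCat.comparison_self (c X) (by rw [D.vid_vcomp, D.vcomp_vid])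
    rw [eq_of_heq k3] at k2
    refine k2.trans ?_
    have k4 := DblCat.transpose_hId (c X)
    have k5 := D.vId_vC (D.hC (D.vId (c X).hat) (G.unitor X))
    have e1 := D.hid_hcomp (c X).hat
    have e2 := D.hcomp_hid (c X).hat
    have e4 : (α.hat c).app X = (c X).hat := rfl
    grind only
  vcell_vcomp {X Y Z} u v := by
    rw [hat_vcell, hat_vcell, hat_vcell]
    have h : D.vcomp (D.vcomp (F.mapV u) (F.mapV v)) (α.app Z)
        = D.vcomp (α.app X) (D.vcomp (G.mapV u) (G.mapV v)) := by
      rw [← F.mapV_vcomp, ← G.mapV_vcomp, α.nat]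
    refine HEq.trans ?_ (DblCat.comparison_vC_comparison _ _ _ _ _ _ _ _ _ h).symm
    congr 1 <;> first | exact F.mapV_vcomp u v | exact G.mapV_vcomp u v | exact proof_irrel_heq _ _
  vcell_vid X := by
    rw [hat_vcell]
    refine HEq.trans ?_ (DblCat.comparison_self (c X) (by rw [D.vid_vcomp, D.vcomp_vid]))
    congr 1 <;> first | exact F.mapV_vid X | exact G.mapV_vid X | exact proof_irrel_heq _ _
  nat {X Y X' Y' f u v g} a := by
    rw [hat_vcell, hat_vcell]
    exact DblCat.transpose_naturality (c X) (c X') (c Y) (c Y') (F.mapSq a) (α.cell g)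
      (α.cell f) (G.mapSq a) (α.nat u).symm (α.nat v).symm (α.cell_nat a)

/-- The axiom for δ is naturality of transposition with `p` and `p'` identities. In the other axiom
both sides are comparison squares over the sides F(u) and G(u), up to unit laws. -/
theorem isHorModification_hat (α : VStrict F G) (c d : ∀ X, D.Companion (α.app X)) :
    IsHorModification (α.hat c) (α.hat d)
      (fun X => DblCat.companionComparison (c X) (d X) rfl) where
  horiz {X Y} f := by
    refine DblCat.transpose_naturality (c X) (d X) (c Y) (d Y) (D.vId (F.mapH f)) (α.cell f)
      (α.cell f) (D.vId (G.mapH f)) _ _ ((D.vId_vC _).trans (D.vC_vId _).symm)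
  vert {X X'} u := by
    have h : ∀ l m, l = F.mapV u → m = G.mapV u →
        D.vcomp l (α.app X') = D.vcomp (α.app X) m := by
      rintro _ _ rfl rfl; exact (α.nat u).symm
    rw [hat_vcell, hat_vcell]
    refine (DblCat.comparison_vC_comparison _ _ _ _ _ _ _ _ _
      (h _ _ (D.vcomp_vid _) (D.vcomp_vid _))).trans (HEq.trans ?_
      (DblCat.comparison_vC_comparison _ _ _ _ _ _ _ _ _
      (h _ _ (D.vid_vcomp _) (D.vid_vcomp _))).symm)
    congr 1 <;> first | exact (D.vcomp_vid _).trans (D.vid_vcomp _).symm | exact proof_irrel_heq _ _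

end VStrict

/-! ### Reduction to a single transformation -/

theorem VModification.IsIdentity.eq {B D : DblCat} {F G : LaxFunctor B D} {α β : VStrict F G}
    {ω : VModification α β} (h : ω.IsIdentity) : α = β := by
  have key : ∀ {X Y : B.Obj} (f : B.H X Y), α.cell f ≍ β.cell f := by
    intro X Y f
    have k1 := ω.horiz f
    obtain ⟨e1, k2⟩ := h X
    obtain ⟨e2, k3⟩ := h Y
    have k4 := D.hC_hId (α.cell f)
    have k5 := D.hId_hC (β.cell f)
    have e3 := D.hcomp_hid (F.mapH f)
    have e4 := D.hcomp_hid (G.mapH f)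
    have e5 := D.hid_hcomp (F.mapH f)
    have e6 := D.hid_hcomp (G.mapH f)
    grind only
  have happ : α.app = β.app := funext fun X => (h X).1
  clear h
  clear ω
  obtain ⟨app, cell, _, _, _, _⟩ := α
  obtain ⟨app', cell', _, _, _, _⟩ := β
  obtain rfl : app = app' := happ
  obtain rfl : @cell = @cell' := by funext X Y f; exact eq_of_heq (key f)
  rfl

theorem VChain.hat_eq {B D : DblCat} : ∀ {F G : LaxFunctor B D} (P : VChain F G)
    (c : P.Companions), P.hat c = P.comp.hat (P.companion c)
  | _, _, single _, _ => rfl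
  | _, _, cons α P, c => by
    change (α.hat c.1).comp (P.hat c.2) = _
    rw [hat_eq P c.2]
    exact VStrict.hat_comp α P.comp c.1 (P.companion c.2)

/-- Transfers `isHorModification_hat` to two strings with equal composites, whose induced
transformations match the single one only propositionally. -/
theorem isHorModification_of_heq {B D : DblCat} {F G : LaxFunctor B D} {α β : VStrict F G}
    (h : α = β) (c : ∀ X, D.Companion (α.app X)) (d : ∀ X, D.Companion (β.app X))
    {H K : HorTransData F G} (hH : H = α.hat c) (hK : K = β.hat d)
    {Θ : ∀ X, D.Glob (H.app X) (K.app X)}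
    (hΘ : ∀ X, Θ X ≍ DblCat.companionComparison (c X) (d X) (by rw [h])) :
    IsHorModification H K Θ := by
  subst h hH hK
  obtain rfl : Θ = _ := funext fun X => eq_of_heq (hΘ X)
  exact α.isHorModification_hat c d

theorem DblCat.gcomp_cast {D : DblCat} {A B : D.Obj} {f f' g g' k k' : D.H A B} (hf : f = f')
    (hg : g = g') (hk : k = k') (a : D.Glob f g) (b : D.Glob g k) :
    D.gcomp (D.cast hf rfl rfl hg a) (D.cast hg rfl rfl hk b)
      = D.cast hf rfl rfl hk (D.gcomp a b) := by
  subst hf hg hk; rfl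

theorem DblCat.cast_vId {D : DblCat} {A B : D.Obj} {f f' : D.H A B} (hf : f = f') :
    D.cast hf rfl rfl hf (D.vId f) = D.vId f' := by
  subst hf; rfl

/-! ### The theorem -/

theorem mainTheorem10 {ι : Type*} {B D : DblCat} (F G : ι → LaxFunctor B D)
    (P Q : ∀ i, VChain (F i) (G i))
    (c : ∀ i, (P i).Companions) (d : ∀ i, (Q i).Companions)
    (ω : ∀ i, VModification (P i).comp (Q i).comp) (hω : ∀ i, (ω i).IsIdentity) :
    (∀ i,
      -- `ω̂` is a horizontal modification between the composites of the induced transformations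
      (((P i).hat (c i)).IsOplax ∧ ((Q i).hat (d i)).IsOplax ∧
        IsHorModification ((Q i).hat (d i)) ((P i).hat (c i)) ((ω i).hat (c i) (d i))) ∧
      -- the assignment `ω(X) ↦ ω̂(X)` is invertible
      (∀ X, Function.Bijective
        (D.lift ((P i).companion (c i) X) ((Q i).companion (d i) X))) ∧
      -- `ω̂` is invertible if the given transformations are
      ((P i).IsInvertible → (Q i).IsInvertible →
        ∃ Ψ : ∀ X, D.Glob (((P i).hat (c i)).app X) (((Q i).hat (d i)).app X),
          IsHorModification ((P i).hat (c i)) ((Q i).hat (d i)) Ψ ∧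
          ∀ X, D.gcomp ((ω i).hat (c i) (d i) X) (Ψ X) = D.vId _ ∧
            D.gcomp (Ψ X) ((ω i).hat (c i) (d i) X) = D.vId _) ∧
      -- its components are the unique comparison isomorphisms of companions
      (∀ X, D.IsGlobIso ((ω i).lift (c i) (d i) X) ∧
        ∀ x : D.Glob ((Q i).pair (d i) X).hat ((P i).pair (c i) X).hat,
          D.IsComparison ((Q i).pair (d i) X) ((P i).pair (c i) X) x ↔
            x = (ω i).lift (c i) (d i) X)) ∧
    -- any two parallel pasting composites of the components are equal
    (∀ {S T : D.Obj} (p q : D.CompanionPair S T) (x y : D.Glob p.hat q.hat),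
      D.Pasting (fun j : ι × B.Obj => (Q j.1).pair (d j.1) j.2)
        (fun j => (P j.1).pair (c j.1) j.2) (fun j => (ω j.1).lift (c j.1) (d j.1) j.2) p q x →
      D.Pasting (fun j : ι × B.Obj => (Q j.1).pair (d j.1) j.2)
        (fun j => (P j.1).pair (c j.1) j.2) (fun j => (ω j.1).lift (c j.1) (d j.1) j.2) p q y →
      x = y) := by
  have hcomp : ∀ i, (P i).comp = (Q i).comp := fun i => (hω i).eq
  have happ : ∀ i X, (Q i).comp.app X = (P i).comp.app X := fun i X => by rw [hcomp i]
  have hlift : ∀ i X, (ω i).lift (c i) (d i) X = DblCat.companionComparison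
      ((Q i).companion (d i) X) ((P i).companion (c i) X) (happ i X) := fun i X =>
    DblCat.lift_eq_companionComparison _ _ (happ i X).symm (hω i X).2
  refine ⟨fun i => ⟨⟨?_, ?_, ?_⟩, fun X => DblCat.lift_bijective _ _, fun _ _ => ?_,
    fun X => ⟨?_, fun x => ?_⟩⟩, fun p q x y hx hy => ?_⟩
  · rw [VChain.hat_eq]
    exact VStrict.hat_isOplax _ _
  · rw [VChain.hat_eq]
    exact VStrict.hat_isOplax _ _
  · refine isHorModification_of_heq (hcomp i).symm ((Q i).companion (d i))
      ((P i).companion (c i)) (VChain.hat_eq _ _) (VChain.hat_eq _ _) fun X => ?_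
    exact (D.cast_heq ..).trans (heq_of_eq (hlift i X))
  -- The inverse is the comparison cell in the opposite direction, a modification for the same
  -- reason.
  · refine ⟨fun X => D.cast ((P i).hat_app (c i) X) rfl rfl ((Q i).hat_app (d i) X)
      (DblCat.companionComparison ((P i).companion (c i) X) ((Q i).companion (d i) X)
        (happ i X).symm), ?_, fun X => ⟨?_, ?_⟩⟩
    · exact isHorModification_of_heq (hcomp i) ((P i).companion (c i))
        ((Q i).companion (d i)) (VChain.hat_eq _ _) (VChain.hat_eq _ _)
        fun X => D.cast_heq ..
    · refine (DblCat.gcomp_cast _ _ _ _ _).trans ?_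
      rw [hlift, DblCat.gcomp_companionComparison, DblCat.companionComparison_self]
      exact DblCat.cast_vId _
    · refine (DblCat.gcomp_cast _ _ _ _ _).trans ?_
      rw [hlift, DblCat.gcomp_companionComparison, DblCat.companionComparison_self]
      exact DblCat.cast_vId _
  · rw [hlift]
    exact DblCat.companionComparison_isGlobIso _ _ _
  · rw [hlift]
    exact DblCat.isComparison_iff ((Q i).pair (d i) X) ((P i).pair (c i) X) (happ i X) x
  · have h : ∀ j : ι × B.Obj, ∃ h : ((Q j.1).pair (d j.1) j.2).vert
        = ((P j.1).pair (c j.1) j.2).vert, (ω j.1).lift (c j.1) (d j.1) j.2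
          = DblCat.companionComparison _ _ h := fun j => ⟨happ j.1 j.2, hlift j.1 j.2⟩
    -- Both composites become the comparison cell from `p` to `q`; only the proof of `p.vert =
    -- q.vert` could differ.
    obtain ⟨_, rfl⟩ := hx.eq_companionComparison h
    obtain ⟨_, rfl⟩ := hy.eq_companionComparison h
    rfl
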